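/- Let $G$ be a finite connected bipartite quad-graph embedded in an oriented surface (inner faces are quadrilaterals; outer faces are not counted), with a chosen 2-colouring of its vertices, and let $G_W$ be its white subgraph: its vertices are the white vertices of $G$, and its edges $e=(x,y)$ are the white diagonals of the inner faces (multiple edges are possible). Let $\theta_e\in\mathbb R$ ($e\in E(G_W)$) be arbitrary, not necessarily integrable, labels and $\Theta_x\in\mathbb R$ ($x\in V(G_W)$) arbitrary constants. To every white vertex $x$ belongs a real variable, denoted $X$ (and $Y$ for the vertex $y$), and $$S=\sum_{e=(x,y)\in E(G_W)}\Lambda(X,Y;\theta_e)+\sum_{x\in V(G_W)}\Theta_x X .$$ Here $\Lambda$ is one of the following functions (complex $\log$ is the principal branch, and $\mathrm{Li}_2(z)=-\int_0^1\log(1-tz)\,\frac{dt}{t}$). * (Q1)$_{\delta=0}$: $\Lambda=-\theta\log|X-Y|$, defined for $X\ne Y$. * (Q1)$_{\delta=1}$: $\Lambda=\lambda(X,Y;\theta):=(iX-iY-\theta)\log(X-Y+i\theta)-(iX-iY+\theta)\log(X-Y-i\theta)-2\pi Y\,\mathrm{sgn}(\theta)$. * (Q2): $\Lambda=\lambda(X,Y;\theta)+(iX+iY-\theta)\log(X+Y+i\theta)-(iX+iY+\theta)\log(X+Y-i\theta)$.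 * (Q3)$_{\delta=0}$: $\Lambda=F(X-Y;\theta)-(\pi-\theta)(X+Y)$, where $F(Z;\theta)=\mathrm{Im}\,\mathrm{Li}_2(e^{Z+i\theta})+\mathrm{Im}\,\mathrm{Li}_2(e^{-Z+i\theta})$. * (Q3)$_{\delta=1}$: $\Lambda=F(X-Y;\theta)+F(X+Y;\theta)$. * (Q4), with purely imaginary half-period ratio $\tau$, $\mathrm{Im}\,\tau>0$ (rectangular lattice): $\Lambda=\sum_{j\in\{1,4\}}\big(I_j(X+Y;\theta)+I_j(X-Y;\theta)\big)$, where $I_j(Z;\theta)=i\int_0^Z s_j(u;\theta)\,du$ and $s_j(\cdot;\theta)$ is the continuous function on $\mathbb R$ with $s_j(0;\theta)=0$ and $\exp s_j(u;\theta)=(-1)^j\,\vartheta_j\!\big(\tfrac{u+i\theta}{2i}\big)\big/\vartheta_j\!\big(\tfrac{u-i\theta}{2i}\big)$, with the Jacobi theta functions $\vartheta_1(v)=2\sum_{n\ge0}(-1)^n e^{i\pi\tau(n+1/2)^2}\sin((2n+1)v)$ and $\vartheta_4(v)=1+2\sum_{n\ge1}(-1)^n e^{i\pi\tau n^2}\cos(2nv)$.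 Let $U=\{X\in\mathbb R^{V(G_W)}:\sum_x X=0\}$ and $S^1_\pm=\{z\in\mathbb C:|z|=1,\ \pm\mathrm{Im}\,z>0\}$. **Strict convexity.** Assume that $G_W$ is connected and has at least two vertices. Then $S$ is real-valued and strictly convex 1. for (Q1)$_{\delta=0}$, on every convex subset of $\{X\in U: X\neq Y\text{ for all edges }(x,y)\}$, if $\theta_e>0$ for all $e$; 2. for (Q1)$_{\delta=1}$, on $U$, if $\theta_e>0$ for all $e$; 3. for (Q2), on $\mathbb R^{V(G_W)}$, if $\theta_e>0$ for all $e$; 4. for (Q3)$_{\delta=0}$, on $U$, if $e^{i\theta_e}\in S^1_+$ for all $e$; 5. for (Q3)$_{\delta=1}$, on $\mathbb R^{V(G_W)}$, if $e^{i\theta_e}\in S^1_+$ for all $e$; 6. for (Q4), on $\mathbb R^{V(G_W)}$, if $e^{i\theta_e}\in S^1_+$ for all $e$ (the functions $s_j(\cdot;\theta_e)$ then exist). **Converse.** Assume that $G_W$ has no loops and no multiple edges. In each of the cases (Q1)$_{\delta=0}$, (Q1)$_{\delta=1}$, (Q2), (Q3)$_{\delta=0}$ and (Q3)$_{\delta=1}$,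 no two labels have opposite signs if $S$ is convex or concave on the space given above (for (Q1)$_{\delta=0}$: on every convex subset of $\{X\in U: X\ne Y\text{ for all edges }(x,y)\}$). More precisely: for (Q1) and (Q2), $\theta_e\ge0$ for all $e$ if $S$ is convex, and $\theta_e\le0$ for all $e$ if $S$ is concave; for (Q3), $e^{i\theta_e}\notin S^1_-$ for all $e$ if $S$ is convex, and $e^{i\theta_e}\notin S^1_+$ for all $e$ if $S$ is concave. -/

import Mathlib

/-- A finite connected bipartite quad-graph, cellularly embedded in an oriented surface, with a chosen
2-colouring, given by its rotation system. `V` are the vertices, `D` the darts (oriented edges) and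
`F` the inner (quadrilateral) faces. Every orbit of the face permutation that is not listed in `F`
is an outer face (or a hole of the surface), on which nothing is required. Multiple edges are allowed. -/
structure QuadGraph (V D F : Type*) where
  /-- the initial vertex of a dart -/
  origin : D → V
  /-- the same edge with the opposite orientation -/
  rev : Equiv.Perm D
  /-- the next dart in counterclockwise order around the initial vertex -/
  rot : Equiv.Perm D
  rev_rev : ∀ d, rev (rev d) = d
  rev_ne : ∀ d, rev d ≠ d
  origin_surjective : Function.Surjective origin
  /-- the darts issuing from one vertex form one cycle of `rot` -/
  origin_eq_iff : ∀ d d', origin d = origin d' ↔ rot.SameCycle d d'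
  /-- `true` for white vertices, `false` for black ones -/
  white : V → Bool
  white_rev : ∀ d, white (origin (rev d)) = !white (origin d)
  connected : (SimpleGraph.fromRel fun v w : V => ∃ d, origin d = v ∧ origin (rev d) = w).Connected
  /-- a dart on the boundary of the face (face on the left), issuing from a white corner -/
  start : F → D
  start_white : ∀ f, white (origin (start f)) = true
  /-- inner faces have exactly four sides; `d ↦ rot⁻¹ (rev d)` runs along the boundary of the face
  on the left of a dart -/
  face_four : ∀ f, (fun d => rot.symm (rev d))^[4] (start f) = start f
  face_ne_two : ∀ f, (fun d => rot.symm (rev d))^[2] (start f) ≠ start f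
  /-- different inner faces have different boundary cycles -/
  face_inj : ∀ f g, (rot⁻¹ * rev).SameCycle (start f) (start g) → f = g

namespace QuadGraph

variable {V D F : Type*} (G : QuadGraph V D F)

/-- The next dart on the boundary of the face on the left. -/
def next (d : D) : D := G.rot.symm (G.rev d)

/-- The vertices of the white subgraph. -/
abbrev WhiteVertex : Type _ := {v : V // G.white v = true}

theorem white_next (d : D) : G.white (G.origin (G.next d)) = !G.white (G.origin d) := by
  have h : G.origin (G.next d) = G.origin (G.rev d) := by
    rw [G.origin_eq_iff]
    exact ⟨1, by simp [next]⟩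
  rw [h, G.white_rev]

/-- The edges of the white subgraph are the white diagonals of the inner faces, hence are indexed by `F`.
`G.src e` and `G.tgt e` are the two ends `x`, `y` of the edge `e = (x, y)`. -/
def src (e : F) : G.WhiteVertex := ⟨G.origin (G.start e), G.start_white e⟩

/-- The white corner of the face `e` opposite to `G.src e`. -/
def tgt (e : F) : G.WhiteVertex :=
  ⟨G.origin (G.next (G.next (G.start e))), by simp [white_next, G.start_white e]⟩

/-- The white subgraph is connected (as adjacency is all that matters here, parallel edges are merged). -/
def WhiteConnected : Prop :=
  (SimpleGraph.fromRel fun x y : G.WhiteVertex => ∃ e : F, G.src e = x ∧ G.tgt e = y).Connected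

/-- The white subgraph has neither loops nor multiple edges. -/
def WhiteSimple : Prop :=
  (∀ e, G.src e ≠ G.tgt e) ∧ ∀ e e', s(G.src e, G.tgt e) = s(G.src e', G.tgt e') → e = e'

/-- The functional `S = ∑_{e = (x, y)} Λ(X, Y; θ_e) + ∑_x Θ_x X` on the white subgraph. -/
noncomputable def action [Fintype V] [Fintype F] (Λ : ℝ → ℝ → ℝ → ℂ) (θ : F → ℝ)
    (Θ : G.WhiteVertex → ℝ) (X : G.WhiteVertex → ℝ) : ℂ :=
  ∑ e, Λ (X (G.src e)) (X (G.tgt e)) (θ e) + ∑ x, ((Θ x * X x : ℝ) : ℂ)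

/-- The subspace `U`. -/
def subspaceU [Fintype V] : Set (G.WhiteVertex → ℝ) := {X | ∑ x, X x = 0}

/-- The points where `X ≠ Y` for all edges `(x, y)`. -/
def offDiagonal : Set (G.WhiteVertex → ℝ) := {X | ∀ e, X (G.src e) ≠ X (G.tgt e)}

end QuadGraph

/-- `S` is real-valued on `s` and, as a real function, strictly convex there. -/
def RealStrictConvexOn {E : Type*} [AddCommGroup E] [Module ℝ E] (s : Set E) (S : E → ℂ) : Prop :=
  (∀ X ∈ s, (S X).im = 0) ∧ StrictConvexOn ℝ s fun X => (S X).re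

/-- Convexity of the real part. -/
def ReConvexOn {E : Type*} [AddCommGroup E] [Module ℝ E] (s : Set E) (S : E → ℂ) : Prop :=
  ConvexOn ℝ s fun X => (S X).re

/-- Concavity of the real part. -/
def ReConcaveOn {E : Type*} [AddCommGroup E] [Module ℝ E] (s : Set E) (S : E → ℂ) : Prop :=
  ConcaveOn ℝ s fun X => (S X).re

/-- The upper open unit half circle. -/
def upperHalfCircle : Set ℂ := {z | ‖z‖ = 1 ∧ 0 < z.im}

/-- The lower open unit half circle. -/
def lowerHalfCircle : Set ℂ := {z | ‖z‖ = 1 ∧ z.im < 0}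

/-- The edge function of (Q1) with `δ = 0` (used only for `X ≠ Y`). -/
noncomputable def edgeQ1zero (X Y θ : ℝ) : ℂ := ((-θ * Real.log |X - Y| : ℝ) : ℂ)

/-- The edge function of (Q1) with `δ = 1`; `log` is the principal branch. -/
noncomputable def edgeQ1one (X Y θ : ℝ) : ℂ :=
  (Complex.I * X - Complex.I * Y - θ) * Complex.log (X - Y + Complex.I * θ)
    - (Complex.I * X - Complex.I * Y + θ) * Complex.log (X - Y - Complex.I * θ)
    - 2 * Real.pi * Y * Real.sign θ

/-- The edge function of (Q2); `log` is the principal branch. -/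
noncomputable def edgeQ2 (X Y θ : ℝ) : ℂ :=
  (Complex.I * X - Complex.I * Y - θ) * Complex.log (X - Y + Complex.I * θ)
    - (Complex.I * X - Complex.I * Y + θ) * Complex.log (X - Y - Complex.I * θ)
    + (Complex.I * X + Complex.I * Y - θ) * Complex.log (X + Y + Complex.I * θ)
    - (Complex.I * X + Complex.I * Y + θ) * Complex.log (X + Y - Complex.I * θ)
    - 2 * Real.pi * Y * Real.sign θ

/-- The principal branch of the dilogarithm, `Li₂(z) = -∫₀^z log(1 - u) / u du` along the segment. -/
noncomputable def dilog (z : ℂ) : ℂ := -∫ t in (0 : ℝ)..1, Complex.log (1 - t * z) / t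

/-- `Im Li₂(exp(Z + iθ)) + Im Li₂(exp(-Z + iθ))`. -/
noncomputable def imDilogSum (Z θ : ℝ) : ℝ :=
  (dilog (Complex.exp (Z + Complex.I * θ))).im + (dilog (Complex.exp (-Z + Complex.I * θ))).im

/-- The edge function of (Q3) with `δ = 0`. -/
noncomputable def edgeQ3zero (X Y θ : ℝ) : ℂ :=
  ((imDilogSum (X - Y) θ - (Real.pi - θ) * (X + Y) : ℝ) : ℂ)

/-- The edge function of (Q3) with `δ = 1`. -/
noncomputable def edgeQ3one (X Y θ : ℝ) : ℂ :=
  ((imDilogSum (X - Y) θ + imDilogSum (X + Y) θ : ℝ) : ℂ)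

/-- The Jacobi theta function `ϑ₁` with half-period ratio `τ`. -/
noncomputable def thetaOne (τ v : ℂ) : ℂ :=
  2 * ∑' n : ℕ, (-1) ^ n * Complex.exp (Complex.I * Real.pi * τ * ((n : ℂ) + 1 / 2) ^ 2)
    * Complex.sin ((2 * n + 1) * v)

/-- The Jacobi theta function `ϑ₄` with half-period ratio `τ`. -/
noncomputable def thetaFour (τ v : ℂ) : ℂ :=
  1 + 2 * ∑' n : ℕ, (-1) ^ (n + 1) * Complex.exp (Complex.I * Real.pi * τ * ((n : ℂ) + 1) ^ 2)
    * Complex.cos (2 * (n + 1) * v)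

/-- `-ϑ₁((u + iθ) / 2i) / ϑ₁((u - iθ) / 2i)`. -/
noncomputable def thetaRatioOne (τ : ℂ) (θ u : ℝ) : ℂ :=
  -(thetaOne τ ((u + Complex.I * θ) / (2 * Complex.I))
    / thetaOne τ ((u - Complex.I * θ) / (2 * Complex.I)))

/-- `ϑ₄((u + iθ) / 2i) / ϑ₄((u - iθ) / 2i)`. -/
noncomputable def thetaRatioFour (τ : ℂ) (θ u : ℝ) : ℂ :=
  thetaFour τ ((u + Complex.I * θ) / (2 * Complex.I))
    / thetaFour τ ((u - Complex.I * θ) / (2 * Complex.I))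

/-- `s` is the continuous logarithm of `g` along the real line with `s(0) = 0`. There is at most one. -/
def IsLogAlong (g s : ℝ → ℂ) : Prop :=
  Continuous s ∧ s 0 = 0 ∧ ∀ u, Complex.exp (s u) = g u

/-- The continuous logarithm of `g` along the real line that vanishes at `0`. -/
noncomputable def logAlong (g : ℝ → ℂ) : ℝ → ℂ := Classical.epsilon (IsLogAlong g)

/-- `I(Z) = i ∫₀^Z log g(u) du`. -/
noncomputable def logIntegral (g : ℝ → ℂ) (Z : ℝ) : ℂ :=
  Complex.I * ∫ u in (0 : ℝ)..Z, logAlong g u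

/-- The edge function of (Q4), for the half-period ratio `τ`. -/
noncomputable def edgeQ4 (τ : ℂ) (X Y θ : ℝ) : ℂ :=
  logIntegral (thetaRatioOne τ θ) (X + Y) + logIntegral (thetaRatioFour τ θ) (X + Y)
    + logIntegral (thetaRatioOne τ θ) (X - Y) + logIntegral (thetaRatioFour τ θ) (X - Y)

open Filter Topology

/-! ### Strict convexity of sums of edge functions -/

/-! In every case the real part of the edge function is `f (X - Y)`, possibly plus `f (X + Y)`, plus
a linear term, with `f` a function of one real variable. The linear terms, including those with `Θ`,
do not affect convexity, so only `f` and the family of linear forms matter.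

Strict convexity. For a positive label `f` is strictly convex: it is `-θ log |Z|` on a half-line for
(Q1) with `δ = 0`, and otherwise `f'` is strictly increasing. For (Q1) with `δ = 1` and (Q2), `f'`
is `-2 arg (Z + iθ)`. For (Q3) it is `rayArg θ Z - rayArg θ (-Z)`, where `rayArg` is `-arg (1 - exp
(Z + iθ))` and has a derivative with the sign of `sin θ`. For (Q4) the Jacobi triple product
(`exists_tendsto_triple_product`) writes the theta quotients as infinite products of factors `1 -
exp (Z + iθ)` over their conjugates; hence their arguments are convergent sums of shifted copies of
`rayArg` (`thetaLine_div`), and monotonicity is inherited termwise. A sum of strictly convex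
functions of linear forms is strictly convex where the forms separate points. In a connected graph
the differences determine `X` up to a constant, which is fixed by `∑ X = 0` or by one form `X + Y`.

Converse. For every label, `f'` exists near both ends of the line and has limits there, so the
second differences of `f` vanish at infinity. Move along a ray `r • P`, where `P` agrees at the ends
of one edge `e₀` only, and test convexity in the direction `edgeVector`. As `r → ∞` the
contributions of all other edges, and of the forms `X + Y`, disappear, and the second difference of
`f e₀` alone remains (`second_diff_nonneg_of_eventually`). It must be nonnegative, whereas a label
of the wrong sign makes `-f` strictly convex. -/

theorem strictConvexOn_sum_comp_linear {E ι : Type*} [AddCommGroup E] [Module ℝ E] [Fintype ι]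
    {C : Set E} (hC : Convex ℝ C) (φ : ι → E →ₗ[ℝ] ℝ) (f : ι → ℝ → ℝ) (J : ι → Set ℝ)
    (hf : ∀ i, StrictConvexOn ℝ (J i) (f i)) (hJ : ∀ i, ∀ x ∈ C, φ i x ∈ J i)
    (hsep : ∀ x ∈ C, ∀ y ∈ C, (∀ i, φ i x = φ i y) → x = y) (L : E →ₗ[ℝ] ℝ) :
    StrictConvexOn ℝ C fun x => ∑ i, f i (φ i x) + L x := by
  refine ⟨hC, fun x hx y hy hxy a b ha hb hab => ?_⟩
  obtain ⟨i, hi⟩ : ∃ i, φ i x ≠ φ i y := by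
    by_contra! h
    exact hxy (hsep x hx y hy h)
  have key : ∑ i, f i (φ i (a • x + b • y)) < ∑ i, (a * f i (φ i x) + b * f i (φ i y)) := by
    refine Finset.sum_lt_sum (fun j _ => ?_) ⟨i, Finset.mem_univ i, ?_⟩
    · have := (hf j).convexOn.2 (hJ j x hx) (hJ j y hy) ha.le hb.le hab
      simpa using this
    · have := (hf i).2 (hJ i x hx) (hJ i y hy) hi ha hb hab
      simpa using this
  rw [Finset.sum_add_distrib, ← Finset.mul_sum, ← Finset.mul_sum] at key
  simp only [map_add, map_smul, smul_eq_mul] at key ⊢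
  linarith

/-- A function that is constant along the edges of a connected graph is constant. -/
theorem eq_of_connected_fromRel {W F α : Type*} {s t : F → W}
    (h : (SimpleGraph.fromRel fun x y : W => ∃ e : F, s e = x ∧ t e = y).Connected)
    {d : W → α} (hd : ∀ e, d (s e) = d (t e)) (x y : W) : d x = d y := by
  obtain ⟨p⟩ := h.preconnected x y
  induction p with
  | nil => rfl
  | cons hadj _ ih =>
    rw [← ih]
    rw [SimpleGraph.fromRel_adj] at hadj
    rcases hadj.2 with ⟨e, rfl, rfl⟩ | ⟨e, rfl, rfl⟩
    · exact hd e
    · exact (hd e).symm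

theorem exists_edge_of_connected_fromRel {W F : Type*} [Nontrivial W] {s t : F → W}
    (h : (SimpleGraph.fromRel fun x y : W => ∃ e : F, s e = x ∧ t e = y).Connected) :
    Nonempty F := by
  by_contra hF
  rw [not_nonempty_iff] at hF
  obtain ⟨x, y, hxy⟩ := exists_pair_ne W
  exact hxy (eq_of_connected_fromRel h (d := id) (fun e => hF.elim e) x y)

section EdgeForms

variable {W F : Type*} (s t : F → W)

/-- The linear form `X ↦ X (s e) - X (t e)`. -/
def edgeDiff (e : F) : (W → ℝ) →ₗ[ℝ] ℝ :=
  LinearMap.proj (R := ℝ) (φ := fun _ : W => ℝ) (s e) - LinearMap.proj (t e)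

/-- The linear form `X ↦ X (s e) + X (t e)`. -/
def edgeSum (e : F) : (W → ℝ) →ₗ[ℝ] ℝ :=
  LinearMap.proj (R := ℝ) (φ := fun _ : W => ℝ) (s e) + LinearMap.proj (t e)

@[simp] theorem edgeDiff_apply (e : F) (X : W → ℝ) : edgeDiff s t e X = X (s e) - X (t e) := rfl

@[simp] theorem edgeSum_apply (e : F) (X : W → ℝ) : edgeSum s t e X = X (s e) + X (t e) := rfl

theorem convex_sum_eq_zero [Fintype W] : Convex ℝ {X : W → ℝ | ∑ x, X x = 0} := by
  intro X hX Y hY a b _ _ _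
  simp only [Set.mem_ofPred_eq] at hX hY ⊢
  simp [Finset.sum_add_distrib, ← Finset.mul_sum, hX, hY]

variable {s t} [Fintype F]

/-- Two points with equal edge differences differ by a constant vector, by connectedness; both have
coordinate sum zero, so the constant is zero. -/
theorem strictConvexOn_edge_sum_of_sum_eq_zero [Fintype W]
    (hcon : (SimpleGraph.fromRel fun x y : W => ∃ e : F, s e = x ∧ t e = y).Connected)
    {C : Set (W → ℝ)} (hC : Convex ℝ C) (hCU : C ⊆ {X | ∑ x, X x = 0})
    (f : F → ℝ → ℝ) (J : F → Set ℝ) (hf : ∀ e, StrictConvexOn ℝ (J e) (f e))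
    (hJ : ∀ e, ∀ X ∈ C, X (s e) - X (t e) ∈ J e) (L : (W → ℝ) →ₗ[ℝ] ℝ) :
    StrictConvexOn ℝ C fun X => ∑ e, f e (X (s e) - X (t e)) + L X := by
  refine strictConvexOn_sum_comp_linear hC (edgeDiff s t) f J hf hJ (fun X hX Y hY h => ?_) L
  have hX' := hCU hX
  have hY' := hCU hY
  simp only [Set.mem_ofPred_eq] at hX' hY'
  have hd := eq_of_connected_fromRel hcon (d := fun x => X x - Y x) (fun e => by
    have := h e
    simp only [edgeDiff_apply] at this
    linarith)
  funext x
  have h0 : ∑ y, (X y - Y y) = 0 := by rw [Finset.sum_sub_distrib, hX', hY', sub_zero]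
  rw [Finset.sum_congr rfl fun y _ => hd y x, Finset.sum_const, smul_eq_zero] at h0
  rcases h0 with h0 | h0
  · rw [Finset.card_eq_zero] at h0
    exact absurd (Finset.mem_univ x) (by simp [h0])
  · linarith

/-- The differences leave a constant vector undetermined. A single sum form `X + Y` sees twice that
constant, and nontriviality guarantees that there is an edge to supply it. -/
theorem strictConvexOn_univ_edge_sum [Nontrivial W]
    (hcon : (SimpleGraph.fromRel fun x y : W => ∃ e : F, s e = x ∧ t e = y).Connected)
    (f g : F → ℝ → ℝ) (hf : ∀ e, StrictConvexOn ℝ Set.univ (f e))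
    (hg : ∀ e, StrictConvexOn ℝ Set.univ (g e)) (L : (W → ℝ) →ₗ[ℝ] ℝ) :
    StrictConvexOn ℝ Set.univ fun X : W → ℝ =>
      ∑ e, f e (X (s e) - X (t e)) + ∑ e, g e (X (s e) + X (t e)) + L X := by
  have key := strictConvexOn_sum_comp_linear (C := (Set.univ : Set (W → ℝ))) convex_univ
    (Sum.elim (edgeDiff s t) (edgeSum s t)) (Sum.elim f g) (fun _ => Set.univ)
    (by rintro (e | e) <;> simp [hf, hg]) (by simp) (fun X _ Y _ h => ?_) L
  · simpa using key
  · have hd := eq_of_connected_fromRel hcon (d := fun x => X x - Y x) (fun e => by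
      have := h (Sum.inl e)
      simp only [Sum.elim_inl, edgeDiff_apply] at this
      linarith)
    obtain ⟨e⟩ := exists_edge_of_connected_fromRel hcon
    have h1 := h (Sum.inl e)
    have h2 := h (Sum.inr e)
    simp only [Sum.elim_inl, Sum.elim_inr, edgeDiff_apply, edgeSum_apply] at h1 h2
    funext x
    have := hd x (s e)
    linarith

end EdgeForms

/-! ### Vanishing second differences -/

/-- The second differences of `f` tend to zero at both ends of the real line. -/
def SecondDiffVanishes (f : ℝ → ℝ) : Prop :=
  ∀ a, Tendsto (fun Z => f (Z + a) + f (Z - a) - 2 * f Z) (atBot ⊔ atTop) (𝓝 0)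

theorem SecondDiffVanishes.neg {f : ℝ → ℝ} (hf : SecondDiffVanishes f) :
    SecondDiffVanishes fun Z => -f Z := by
  intro a
  have := (hf a).neg
  rw [neg_zero] at this
  refine this.congr fun Z => ?_
  ring

/-- By the mean value inequality for `f x - l * x`, the increment `f (Z + b) - f Z` tends to `l *
b`; the limits for `b = a` and `b = -a` cancel. -/
theorem tendsto_second_diff_atTop {f f' : ℝ → ℝ} {l : ℝ} (hf : ∀ᶠ Z in atTop, HasDerivAt f (f' Z) Z)
    (hl : Tendsto f' atTop (𝓝 l)) (a : ℝ) :
    Tendsto (fun Z => f (Z + a) + f (Z - a) - 2 * f Z) atTop (𝓝 0) := by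
  have key : ∀ b, Tendsto (fun Z => f (Z + b) - f Z - l * b) atTop (𝓝 0) := by
    intro b
    rw [Metric.tendsto_nhds]
    intro ε hε
    -- The `+ 1` keeps the final bound strict and allows `b = 0`.
    have hε' : 0 < ε / (|b| + 1) := by positivity
    have h1 := hf.and ((Metric.tendsto_nhds.1 hl) _ hε')
    obtain ⟨M, hM⟩ := eventually_atTop.1 h1
    filter_upwards [eventually_ge_atTop (M + |b|)] with Z hZ
    have hb : 0 ≤ |b| := abs_nonneg b
    have hb' := neg_abs_le b
    have hc := Convex.norm_image_sub_le_of_norm_hasDerivWithin_le (s := Set.Ici M)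
      (f := fun x => f x - l * x) (f' := fun x => f' x - l * 1) (C := ε / (|b| + 1))
      (fun x hx => (((hM x hx).1.sub ((hasDerivAt_id x).const_mul l))).hasDerivWithinAt)
      (fun x hx => by
        have := (hM x hx).2
        rw [Real.dist_eq] at this
        rw [mul_one, Real.norm_eq_abs]
        exact this.le) (convex_Ici M) (x := Z) (y := Z + b)
      (by simp only [Set.mem_Ici]; linarith) (by simp only [Set.mem_Ici]; linarith)
    rw [Real.dist_eq, sub_zero]
    rw [Real.norm_eq_abs, Real.norm_eq_abs, add_sub_cancel_left] at hc
    have e1 : f (Z + b) - l * (Z + b) - (f Z - l * Z) = f (Z + b) - f Z - l * b := by ring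
    rw [e1] at hc
    refine hc.trans_lt ?_
    rw [div_mul_eq_mul_div, div_lt_iff₀ (by positivity)]
    nlinarith
  have := (key a).add (key (-a))
  rw [add_zero] at this
  refine this.congr fun Z => ?_
  rw [← sub_eq_add_neg]
  ring

/-- Differentiability is required only near the two ends, since `log |Z|` and the dilogarithm sum
with `exp (iθ) = 1` are covered too, and these may be singular at `0`. The lower end follows from
the upper one by reflection. -/
theorem SecondDiffVanishes.of_hasDerivAt {f f' : ℝ → ℝ} {l l' : ℝ}
    (hf : ∀ᶠ Z in atBot ⊔ atTop, HasDerivAt f (f' Z) Z)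
    (hl : Tendsto f' atTop (𝓝 l)) (hl' : Tendsto f' atBot (𝓝 l')) : SecondDiffVanishes f := by
  rw [eventually_sup] at hf
  intro a
  refine Tendsto.sup ?_ (tendsto_second_diff_atTop hf.2 hl a)
  have h1 : ∀ᶠ Z in atTop, HasDerivAt (fun x => f (-x)) (-f' (-Z)) Z := by
    filter_upwards [tendsto_neg_atTop_atBot.eventually hf.1] with Z hZ
    have := hZ.scomp Z (hasDerivAt_neg Z)
    simpa [Function.comp_def] using this
  have h2 := tendsto_second_diff_atTop h1 (hl'.comp tendsto_neg_atTop_atBot).neg a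
  have h3 := h2.comp tendsto_neg_atBot_atTop
  refine h3.congr fun Z => ?_
  simp only [Function.comp, neg_add, neg_neg, neg_sub, sub_neg_eq_add]
  ring_nf

theorem Monotone.exists_tendsto_atTop_atBot {f : ℝ → ℝ} (hf : Monotone f) {M : ℝ}
    (hM : ∀ x, |f x| ≤ M) : (∃ l, Tendsto f atTop (𝓝 l)) ∧ ∃ l, Tendsto f atBot (𝓝 l) :=
  ⟨⟨_, tendsto_atTop_ciSup hf ⟨M, by rintro _ ⟨x, rfl⟩; exact (abs_le.1 (hM x)).2⟩⟩,
    ⟨_, tendsto_atBot_ciInf hf ⟨-M, by rintro _ ⟨x, rfl⟩; exact (abs_le.1 (hM x)).1⟩⟩⟩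

theorem SecondDiffVanishes.of_monotone_deriv {f f' : ℝ → ℝ} {M : ℝ}
    (hf : ∀ Z, HasDerivAt f (f' Z) Z) (hmono : Monotone f') (hM : ∀ x, |f' x| ≤ M) :
    SecondDiffVanishes f := by
  obtain ⟨⟨l, hl⟩, l', hl'⟩ := hmono.exists_tendsto_atTop_atBot hM
  exact .of_hasDerivAt (Eventually.of_forall hf) hl hl'

theorem SecondDiffVanishes.of_antitone_deriv {f f' : ℝ → ℝ} {M : ℝ}
    (hf : ∀ Z, HasDerivAt f (f' Z) Z) (hanti : Antitone f') (hM : ∀ x, |f' x| ≤ M) :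
    SecondDiffVanishes f := by
  have := (SecondDiffVanishes.of_monotone_deriv (M := M) (fun Z => (hf Z).neg) hanti.neg
    (by simpa using hM)).neg
  simpa using this

theorem secondDiffVanishes_zero : SecondDiffVanishes 0 := fun a => by simp

/-! ### The converse: localisation at one edge -/

section Localise

variable {W F : Type*} {s t : F → W}

/-- The function that equals `1` at the source, `-1` at the target of an edge, and `0` elsewhere. -/
noncomputable def edgeVector (s t : F → W) (e : F) : W → ℝ := by
  classical exact Pi.single (s e) 1 - Pi.single (t e) 1

theorem edgeVector_src {e : F} (h : s e ≠ t e) : edgeVector s t e (s e) = 1 := by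
  classical simp [edgeVector, h]

theorem edgeVector_tgt {e : F} (h : s e ≠ t e) : edgeVector s t e (t e) = -1 := by
  classical simp [edgeVector, h.symm]

theorem sum_edgeVector [Fintype W] (e : F) : ∑ x, edgeVector s t e x = 0 := by
  classical simp [edgeVector]

theorem abs_edgeVector_le (e : F) (x : W) : |edgeVector s t e x| ≤ 1 := by
  classical
  simp only [edgeVector, Pi.sub_apply, Pi.single_apply]
  split_ifs <;> simp

theorem tendsto_mul_add_atBot_sup_atTop {d : ℝ} (hd : d ≠ 0) (c : ℝ) :
    Tendsto (fun r : ℝ => r * d + c) atTop (atBot ⊔ atTop) := by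
  rcases hd.lt_or_gt with h | h
  · exact (tendsto_atBot_add_const_right _ c
      (tendsto_id.atTop_mul_const_of_neg h)).mono_right le_sup_left
  · exact (tendsto_atTop_add_const_right _ c (tendsto_id.atTop_mul_const h)).mono_right le_sup_right

variable [Fintype F]

/-- Along `r • P + c • edgeVector` the edge `e₀` sees the difference `2 * c`, whatever `r` is; this
is why the coefficients are halved. Every other argument is a multiple of `r` plus a bounded shift,
so it runs to infinity, where second differences vanish. The linear part `L` has none. -/
theorem second_diff_nonneg_of_eventually {S : (W → ℝ) → ℝ} {f g : F → ℝ → ℝ} {L : (W → ℝ) →ₗ[ℝ] ℝ}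
    (hS : ∀ X, S X = ∑ e, f e (X (s e) - X (t e)) + ∑ e, g e (X (s e) + X (t e)) + L X)
    (hf : ∀ e, SecondDiffVanishes (f e)) (hg : ∀ e, SecondDiffVanishes (g e))
    {e₀ : F} (he₀ : s e₀ ≠ t e₀) {P : W → ℝ} (hP₀ : P (s e₀) = P (t e₀))
    (hP : ∀ e ≠ e₀, P (s e) ≠ P (t e)) (hP' : ∀ e, P (s e) + P (t e) ≠ 0 ∨ g e = 0) (z a : ℝ)
    (hconv : ∀ᶠ r : ℝ in atTop, 0 ≤ S (r • P + ((z + a) / 2) • edgeVector s t e₀)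
      + S (r • P + ((z - a) / 2) • edgeVector s t e₀)
      - 2 * S (r • P + (z / 2) • edgeVector s t e₀)) :
    0 ≤ f e₀ (z + a) + f e₀ (z - a) - 2 * f e₀ z := by
  classical
  set q := edgeVector s t e₀ with hq
  have hqs : q (s e₀) = 1 := edgeVector_src he₀
  have hqt : q (t e₀) = -1 := edgeVector_tgt he₀
  have hfe : ∀ e, Tendsto (fun r : ℝ =>
      f e (r * (P (s e) - P (t e)) + ((z + a) / 2) * (q (s e) - q (t e)))
      + f e (r * (P (s e) - P (t e)) + ((z - a) / 2) * (q (s e) - q (t e)))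
      - 2 * f e (r * (P (s e) - P (t e)) + (z / 2) * (q (s e) - q (t e)))) atTop
      (𝓝 (if e = e₀ then f e₀ (z + a) + f e₀ (z - a) - 2 * f e₀ z else 0)) := by
    intro e
    split_ifs with h
    · subst h
      rw [hP₀, hqs, hqt]
      refine tendsto_const_nhds.congr fun r => ?_
      congr 3 <;> ring_nf
    · have := (hf e (a / 2 * (q (s e) - q (t e)))).comp (tendsto_mul_add_atBot_sup_atTop
        (sub_ne_zero.2 (hP e h)) (z / 2 * (q (s e) - q (t e))))
      refine this.congr fun r => ?_
      simp only [Function.comp]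
      congr 3 <;> ring_nf
  have hge : ∀ e, Tendsto (fun r : ℝ =>
      g e (r * (P (s e) + P (t e)) + ((z + a) / 2) * (q (s e) + q (t e)))
      + g e (r * (P (s e) + P (t e)) + ((z - a) / 2) * (q (s e) + q (t e)))
      - 2 * g e (r * (P (s e) + P (t e)) + (z / 2) * (q (s e) + q (t e)))) atTop (𝓝 0) := by
    intro e
    rcases hP' e with h | h
    · have := (hg e (a / 2 * (q (s e) + q (t e)))).comp (tendsto_mul_add_atBot_sup_atTop
        h (z / 2 * (q (s e) + q (t e))))
      refine this.congr fun r => ?_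
      simp only [Function.comp]
      congr 3 <;> ring_nf
    · simp [h]
  have hlim := (tendsto_finsetSum Finset.univ fun e _ => hfe e).add
    (tendsto_finsetSum Finset.univ fun e _ => hge e)
  rw [Finset.sum_ite_eq' Finset.univ e₀, if_pos (Finset.mem_univ _), Finset.sum_const_zero,
    add_zero] at hlim
  refine ge_of_tendsto hlim (hconv.mono fun r hr => hr.trans_eq ?_)
  have e1 : ∀ (c : ℝ), S (r • P + c • q)
      = ∑ e, f e (r * (P (s e) - P (t e)) + c * (q (s e) - q (t e)))
      + ∑ e, g e (r * (P (s e) + P (t e)) + c * (q (s e) + q (t e))) + (r * L P + c * L q) := by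
    intro c
    rw [hS]
    simp only [Pi.add_apply, Pi.smul_apply, smul_eq_mul, map_add, map_smul]
    congr 2 <;> (refine Finset.sum_congr rfl fun e _ => ?_) <;> congr 1 <;> ring
  rw [e1, e1, e1]
  simp only [Finset.sum_add_distrib, Finset.sum_sub_distrib, ← Finset.mul_sum]
  ring

/-- Number the vertices injectively from `1`, then give `y₀` the number of `x₀`. In a simple graph
no edge but the chosen one then has equal end values, and positivity keeps the sums over edges
nonzero. -/
theorem exists_pos_separating {W : Type*} [Fintype W] (x₀ y₀ : W) : ∃ m : W → ℝ, (∀ x, 0 < m x) ∧ m x₀ = m y₀ ∧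
    ∀ x y, m x = m y → x = y ∨ s(x, y) = s(x₀, y₀) := by
  classical
  let n : W → ℝ := fun x => ((Fintype.equivFin W x : ℕ) : ℝ) + 1
  have hn : Function.Injective n := fun x y h => by
    simp only [n, add_left_inj, Nat.cast_inj] at h
    exact (Fintype.equivFin W).injective (Fin.ext h)
  refine ⟨fun x => if x = y₀ then n x₀ else n x, fun x => ?_, ?_, fun x y h => ?_⟩
  · dsimp only [n]
    split_ifs <;> positivity
  · simp
  · dsimp only at h
    split_ifs at h with h1 h2 h2
    · exact .inl (h1.trans h2.symm)
    · right
      rw [h1, ← hn h, Sym2.eq_swap]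
    · right
      rw [h2, hn h]
    · exact .inl (hn h)

theorem ConvexOn.second_diff_nonneg {E : Type*} [AddCommGroup E] [Module ℝ E] {C : Set E}
    {S : E → ℝ} (h : ConvexOn ℝ C S) {b q : E} {z a : ℝ} (hx : b + ((z + a) / 2) • q ∈ C)
    (hy : b + ((z - a) / 2) • q ∈ C) :
    0 ≤ S (b + ((z + a) / 2) • q) + S (b + ((z - a) / 2) • q) - 2 * S (b + (z / 2) • q) := by
  have := h.2 hx hy (by norm_num : (0 : ℝ) ≤ 1 / 2) (by norm_num : (0 : ℝ) ≤ 1 / 2) (by norm_num)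
  have e : (1 / 2 : ℝ) • (b + ((z + a) / 2) • q) + (1 / 2 : ℝ) • (b + ((z - a) / 2) • q)
      = b + (z / 2) • q := by
    module
  rw [e] at this
  simp only [smul_eq_mul] at this
  linarith

variable [Fintype W] (hsimp : (∀ e, s e ≠ t e) ∧ ∀ e e', s(s e, t e) = s(s e', t e') → e = e')
  {S : (W → ℝ) → ℝ} {f g : F → ℝ → ℝ} {L : (W → ℝ) →ₗ[ℝ] ℝ}
  (hS : ∀ X, S X = ∑ e, f e (X (s e) - X (t e)) + ∑ e, g e (X (s e) + X (t e)) + L X)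
  (hf : ∀ e, SecondDiffVanishes (f e)) (hg : ∀ e, SecondDiffVanishes (g e))

include hsimp hS hf hg

theorem ConvexOn.edge_second_diff_nonneg (hconv : ConvexOn ℝ Set.univ S) (e₀ : F) (z a : ℝ) :
    0 ≤ f e₀ (z + a) + f e₀ (z - a) - 2 * f e₀ z := by
  obtain ⟨m, hm, hm₀, hm'⟩ := exists_pos_separating (s e₀) (t e₀)
  refine second_diff_nonneg_of_eventually hS hf hg (hsimp.1 e₀) hm₀ (fun e he h => ?_)
    (fun e => .inl (add_pos (hm _) (hm _)).ne') z a
    (Eventually.of_forall fun r => hconv.second_diff_nonneg trivial trivial)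
  rcases hm' _ _ h with h | h
  · exact hsimp.1 e h
  · exact he (hsimp.2 _ _ h)

omit hg in
-- Subtracting the mean moves the separating vector into the sum-zero subspace without changing
-- differences; sums over edges may vanish afterwards, which is harmless as `g = 0`. The convex set
-- may depend on `r`, because the off-diagonal domain is not convex.
theorem edge_second_diff_nonneg_of_offDiagonal (hg : g = 0) {z a : ℝ} (e₀ : F)
    (hconv : ∀ P : W → ℝ, ∑ x, P x = 0 → P (s e₀) = P (t e₀) → (∀ e ≠ e₀, P (s e) ≠ P (t e)) →
      ∀ᶠ r : ℝ in atTop, ∃ C, ConvexOn ℝ C S ∧ r • P + ((z + a) / 2) • edgeVector s t e₀ ∈ C ∧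
        r • P + ((z - a) / 2) • edgeVector s t e₀ ∈ C) :
    0 ≤ f e₀ (z + a) + f e₀ (z - a) - 2 * f e₀ z := by
  obtain ⟨m, hm, hm₀, hm'⟩ := exists_pos_separating (s e₀) (t e₀)
  set c := (∑ x, m x) / Fintype.card W with hc
  have hW : (Fintype.card W : ℝ) ≠ 0 := by
    have : Nonempty W := ⟨s e₀⟩
    simp
  have hP₀ : m (s e₀) - c = m (t e₀) - c := by rw [hm₀]
  have hP : ∀ e ≠ e₀, m (s e) - c ≠ m (t e) - c := fun e he h => by
    rcases hm' _ _ (sub_left_injective h) with h | h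
    · exact hsimp.1 e h
    · exact he (hsimp.2 _ _ h)
  refine second_diff_nonneg_of_eventually (P := fun x => m x - c) hS hf
    (fun e => by rw [hg]; exact secondDiffVanishes_zero) (hsimp.1 e₀) hP₀ hP
    (fun e => .inr (by rw [hg]; rfl)) z a ?_
  refine (hconv (fun x => m x - c) ?_ hP₀ hP).mono ?_
  · rw [Finset.sum_sub_distrib, Finset.sum_const, Finset.card_univ, nsmul_eq_mul, hc,
      mul_div_cancel₀ _ hW, sub_self]
  · rintro r ⟨C, hC, h1, h2⟩
    exact hC.second_diff_nonneg h1 h2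

omit hg in
theorem ConvexOn.edge_second_diff_nonneg_of_sum_eq_zero (hg : g = 0)
    (hconv : ConvexOn ℝ {X : W → ℝ | ∑ x, X x = 0} S) (e₀ : F) (z a : ℝ) :
    0 ≤ f e₀ (z + a) + f e₀ (z - a) - 2 * f e₀ z := by
  refine edge_second_diff_nonneg_of_offDiagonal hsimp hS hf hg e₀ fun P hP _ _ =>
    Eventually.of_forall fun r => ⟨_, hconv, ?_, ?_⟩ <;>
  simp [Finset.sum_add_distrib, ← Finset.mul_sum, hP, sum_edgeVector]

omit hg in
-- The convex set tested is just the segment between the two perturbed points. On it the difference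
-- at `e₀` stays positive since `a < z`, and for large `r` no other difference can vanish.
theorem edge_second_diff_nonneg_of_ne (hg : g = 0)
    (hconv : ∀ C ⊆ {X : W → ℝ | ∑ x, X x = 0} ∩ {X | ∀ e, X (s e) ≠ X (t e)}, Convex ℝ C →
      ConvexOn ℝ C S) (e₀ : F) {z a : ℝ} (ha : 0 < a) (haz : a < z) :
    0 ≤ f e₀ (z + a) + f e₀ (z - a) - 2 * f e₀ z := by
  refine edge_second_diff_nonneg_of_offDiagonal hsimp hS hf hg e₀ fun P hP hP₀ hP1 => ?_
  set q := edgeVector s t e₀ with hq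
  have hqs : q (s e₀) = 1 := edgeVector_src (hsimp.1 e₀)
  have hqt : q (t e₀) = -1 := edgeVector_tgt (hsimp.1 e₀)
  -- The perturbation changes an edge difference by at most `2 * c`, and `c ≤ (z + a) / 2` on the
  -- segment.
  have hev : ∀ᶠ r : ℝ in atTop, ∀ e, e ≠ e₀ → z + a < |r * (P (s e) - P (t e))| := by
    rw [eventually_all]
    intro e
    by_cases he : e = e₀
    · simp [he]
    · have hd := abs_pos.2 (sub_ne_zero.2 (hP1 e he))
      filter_upwards [(tendsto_id.atTop_mul_const hd).eventually_gt_atTop (z + a),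
        eventually_ge_atTop 0] with r hr hr0 _
      rwa [abs_mul, abs_of_nonneg hr0]
  refine hev.mono fun r hr => ?_
  refine ⟨_, hconv _ ?_ (convex_segment _ _), left_mem_segment ℝ _ _, right_mem_segment ℝ _ _⟩
  rintro X ⟨u, v, hu, hv, huv, rfl⟩
  obtain ⟨c, hc, hc1, hc2⟩ : ∃ c, u • (r • P + ((z + a) / 2) • q) + v • (r • P + ((z - a) / 2) • q)
      = r • P + c • q ∧ (z - a) / 2 ≤ c ∧ c ≤ (z + a) / 2 := by
    refine ⟨u * ((z + a) / 2) + v * ((z - a) / 2), ?_, ?_, ?_⟩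
    · obtain rfl : v = 1 - u := by linarith
      module
    · nlinarith
    · nlinarith
  rw [hc]
  refine ⟨?_, fun e he => ?_⟩
  · simp [Finset.sum_add_distrib, ← Finset.mul_sum, hP, hq, sum_edgeVector]
  · simp only [Pi.add_apply, Pi.smul_apply, smul_eq_mul] at he
    by_cases h0 : e = e₀
    · subst h0
      rw [hP₀, hqs, hqt] at he
      linarith
    · have h1 := hr e h0
      have h2 : r * (P (s e) - P (t e)) = c * (q (t e) - q (s e)) := by linarith
      rw [h2, abs_mul, abs_of_pos (by linarith : 0 < c)] at h1
      have h3 : |q (t e) - q (s e)| ≤ 2 := by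
        refine (abs_sub _ _).trans ?_
        have := abs_edgeVector_le (s := s) (t := t) e₀ (t e)
        have := abs_edgeVector_le (s := s) (t := t) e₀ (s e)
        rw [← hq] at *
        linarith
      nlinarith

end Localise

/-! ### The edge functions of (Q1) and (Q2) -/

theorem HasDerivAt.complex_im {f : ℝ → ℂ} {f' : ℂ} {x : ℝ} (h : HasDerivAt f f' x) :
    HasDerivAt (fun y => (f y).im) f'.im x :=
  Complex.imCLM.hasFDerivAt.comp_hasDerivAt x h

theorem strictConvexOn_univ_of_hasDerivAt {f f' : ℝ → ℝ} (hf : ∀ Z, HasDerivAt f (f' Z) Z)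
    (hmono : StrictMono f') : StrictConvexOn ℝ Set.univ f := by
  refine StrictMono.strictConvexOn_univ_of_deriv
    (continuous_iff_continuousAt.2 fun Z => (hf Z).continuousAt) ?_
  rwa [show deriv f = f' from funext fun Z => (hf Z).deriv]

theorem StrictConvexOn.second_diff_pos {f : ℝ → ℝ} {J : Set ℝ} (hf : StrictConvexOn ℝ J f)
    {z a : ℝ} (ha : a ≠ 0) (h1 : z + a ∈ J) (h2 : z - a ∈ J) :
    0 < f (z + a) + f (z - a) - 2 * f z := by
  have := hf.2 h1 h2 (fun h => ha (by linarith)) (by norm_num : (0 : ℝ) < 1 / 2)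
    (by norm_num : (0 : ℝ) < 1 / 2) (by norm_num)
  simp only [smul_eq_mul] at this
  rw [show 1 / 2 * (z + a) + 1 / 2 * (z - a) = z by ring] at this
  linarith

/-- A convex set that misses `0` lies in one open half-line, and `log |Z|` is strictly concave on
each of them. -/
theorem strictConvexOn_neg_mul_log_abs {θ : ℝ} (hθ : 0 < θ) {J : Set ℝ} (hJ : Convex ℝ J)
    (h0 : (0 : ℝ) ∉ J) : StrictConvexOn ℝ J fun Z => -θ * Real.log |Z| := by
  have hI : StrictConcaveOn ℝ J Real.log := by
    have hoc : J ⊆ Set.Ioi 0 ∨ J ⊆ Set.Iio 0 := by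
      by_contra! h
      obtain ⟨⟨x, hx, hx0⟩, y, hy, hy0⟩ := And.imp Set.not_subset.1 Set.not_subset.1 h
      rw [Set.mem_Ioi, not_lt] at hx0
      rw [Set.mem_Iio, not_lt] at hy0
      exact h0 (hJ.ordConnected.out hx hy ⟨hx0, hy0⟩)
    rcases hoc with h | h
    · exact strictConcaveOn_log_Ioi.subset h hJ
    · exact strictConcaveOn_log_Iio.subset h hJ
  refine ⟨hJ, fun x hx y hy hxy a b ha hb hab => ?_⟩
  have := hI.2 hx hy hxy ha hb hab
  simp only [smul_eq_mul, Real.log_abs] at this ⊢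
  nlinarith

theorem secondDiffVanishes_neg_mul_log_abs (θ : ℝ) :
    SecondDiffVanishes fun Z => -θ * Real.log |Z| := by
  simp only [Real.log_abs]
  refine .of_hasDerivAt (f' := fun Z => -θ * Z⁻¹) (l := -θ * 0) (l' := -θ * 0) ?_
    (tendsto_inv_atTop_zero.const_mul _) (tendsto_inv_atBot_zero.const_mul _)
  rw [eventually_sup]
  constructor
  · filter_upwards [eventually_lt_atBot 0] with Z hZ
    exact (Real.hasDerivAt_log hZ.ne).const_mul _
  · filter_upwards [eventually_gt_atTop 0] with Z hZ
    exact (Real.hasDerivAt_log hZ.ne').const_mul _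

/-- `(iZ - θ) log(Z + iθ) - (iZ + θ) log(Z - iθ)`. -/
noncomputable def logEdge (θ Z : ℝ) : ℂ :=
  (Complex.I * Z - θ) * Complex.log (Z + Complex.I * θ)
    - (Complex.I * Z + θ) * Complex.log (Z - Complex.I * θ)

theorem edgeQ1one_eq (X Y θ : ℝ) :
    edgeQ1one X Y θ = logEdge θ (X - Y) - ((2 * Real.pi * Real.sign θ * Y : ℝ) : ℂ) := by
  simp only [edgeQ1one, logEdge]
  push_cast
  ring

theorem edgeQ2_eq (X Y θ : ℝ) : edgeQ2 X Y θ
    = logEdge θ (X - Y) + logEdge θ (X + Y) - ((2 * Real.pi * Real.sign θ * Y : ℝ) : ℂ) := by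
  simp only [edgeQ2, logEdge]
  push_cast
  ring

theorem logEdge_zero (Z : ℝ) : logEdge 0 Z = 0 := by simp [logEdge]

theorem line_mem_slitPlane {θ : ℝ} (hθ : θ ≠ 0) (Z : ℝ) :
    (Z : ℂ) + Complex.I * θ ∈ Complex.slitPlane := by
  rw [Complex.mem_slitPlane_iff]
  right
  simpa using hθ

theorem log_line_conj {θ : ℝ} (hθ : θ ≠ 0) (Z : ℝ) : Complex.log (Z - Complex.I * θ)
    = starRingEnd ℂ (Complex.log (Z + Complex.I * θ)) := by
  rw [← Complex.log_conj _ (Complex.slitPlane_arg_ne_pi (line_mem_slitPlane hθ Z))]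
  simp [sub_eq_add_neg]

/-- With `w = Z + iθ` the two terms are `i w log w` and `i` times the conjugate of `w log w`, so
their difference is `-2 Im (w log w)`. -/
theorem logEdge_eq_ofReal {θ : ℝ} (hθ : θ ≠ 0) (Z : ℝ) : logEdge θ Z
    = ((-2 * ((Z + Complex.I * θ) * Complex.log (Z + Complex.I * θ)).im : ℝ) : ℂ) := by
  rw [logEdge, log_line_conj hθ]
  refine Complex.ext ?_ ?_ <;> (simp; try ring)

theorem hasDerivAt_log_line {θ : ℝ} (hθ : θ ≠ 0) (Z : ℝ) :
    HasDerivAt (fun Z : ℝ => Complex.log (Z + Complex.I * θ)) (1 / (Z + Complex.I * θ)) Z := by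
  have h1 : HasDerivAt (fun Z : ℝ => (Z : ℂ) + Complex.I * θ) 1 Z :=
    (Complex.ofRealCLM.hasDerivAt (x := Z)).add_const _
  exact h1.clog_real (line_mem_slitPlane hθ Z)

/-- The derivative of `w log w` is `log w + 1`, and the real `1` drops out of the imaginary part. -/
theorem hasDerivAt_logEdge {θ : ℝ} (hθ : θ ≠ 0) (Z : ℝ) :
    HasDerivAt (fun Z => (logEdge θ Z).re) (-2 * (Complex.log (Z + Complex.I * θ)).im) Z := by
  have h1 : HasDerivAt (fun Z : ℝ => (Z : ℂ) + Complex.I * θ) 1 Z :=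
    (Complex.ofRealCLM.hasDerivAt (x := Z)).add_const _
  have h2 := ((h1.mul (hasDerivAt_log_line hθ Z)).complex_im).const_mul (-2)
  have h0 := Complex.slitPlane_ne_zero (line_mem_slitPlane hθ Z)
  rw [one_mul, mul_one_div_cancel h0, Complex.add_im, Complex.one_im, add_zero] at h2
  refine h2.congr_of_eventuallyEq (Eventually.of_forall fun Z => ?_)
  simp only [logEdge_eq_ofReal hθ, Complex.ofReal_re]
  rfl

theorem hasDerivAt_im_log_line {θ : ℝ} (hθ : θ ≠ 0) (Z : ℝ) :
    HasDerivAt (fun Z : ℝ => -2 * (Complex.log (Z + Complex.I * θ)).im)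
      (2 * θ / (Z ^ 2 + θ ^ 2)) Z := by
  convert! (hasDerivAt_log_line hθ Z).complex_im.const_mul (-2) using 1
  rw [one_div, Complex.inv_im, Complex.normSq_apply]
  simp
  ring

theorem strictMono_im_log_line {θ : ℝ} (hθ : 0 < θ) :
    StrictMono fun Z : ℝ => -2 * (Complex.log (Z + Complex.I * θ)).im :=
  strictMono_of_hasDerivAt_pos (fun Z => hasDerivAt_im_log_line hθ.ne' Z) fun Z => by
    have : 0 < θ ^ 2 := pow_pos hθ 2
    exact div_pos (by linarith) (by positivity)

theorem strictAnti_im_log_line {θ : ℝ} (hθ : θ < 0) :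
    StrictAnti fun Z : ℝ => -2 * (Complex.log (Z + Complex.I * θ)).im :=
  strictAnti_of_hasDerivAt_neg (fun Z => hasDerivAt_im_log_line hθ.ne Z) fun Z => by
    have : 0 < θ ^ 2 := sq_pos_of_neg hθ
    exact div_neg_of_neg_of_pos (by linarith) (by positivity)

theorem strictConvexOn_logEdge {θ : ℝ} (hθ : 0 < θ) :
    StrictConvexOn ℝ Set.univ fun Z => (logEdge θ Z).re :=
  strictConvexOn_univ_of_hasDerivAt (hasDerivAt_logEdge hθ.ne') (strictMono_im_log_line hθ)

theorem strictConvexOn_neg_logEdge {θ : ℝ} (hθ : θ < 0) :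
    StrictConvexOn ℝ Set.univ fun Z => -(logEdge θ Z).re :=
  strictConvexOn_univ_of_hasDerivAt (fun Z => (hasDerivAt_logEdge hθ.ne Z).neg)
    (strictAnti_im_log_line hθ).neg

theorem secondDiffVanishes_logEdge (θ : ℝ) : SecondDiffVanishes fun Z => (logEdge θ Z).re := by
  have hb : ∀ Z : ℝ, |-2 * (Complex.log (Z + Complex.I * θ)).im| ≤ 2 * Real.pi := by
    intro Z
    rw [abs_mul, Complex.log_im]
    simpa using Complex.abs_arg_le_pi (Z + Complex.I * θ)
  rcases lt_trichotomy θ 0 with h | rfl | h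
  · exact .of_antitone_deriv (hasDerivAt_logEdge h.ne) (strictAnti_im_log_line h).antitone hb
  · simp only [logEdge_zero]
    exact secondDiffVanishes_zero
  · exact .of_monotone_deriv (hasDerivAt_logEdge h.ne') (strictMono_im_log_line h).monotone hb

/-! ### The dilogarithm along exponential rays -/

theorem dilog_ofReal_mul {r : ℝ} (hr : 0 < r) (c : ℂ) :
    dilog (r * c) = -∫ u in (0 : ℝ)..r, Complex.log (1 - u * c) / u := by
  have h := intervalIntegral.integral_comp_mul_left (a := 0) (b := 1)
    (fun u : ℝ => Complex.log (1 - u * c) / u) hr.ne'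
  rw [mul_zero, mul_one] at h
  have hr' : (r : ℂ) ≠ 0 := by exact_mod_cast hr.ne'
  rw [dilog, ← smul_inv_smul₀ hr.ne' (∫ u in (0 : ℝ)..r, Complex.log (1 - u * c) / u), ← h,
    ← intervalIntegral.integral_smul]
  congr 1
  refine intervalIntegral.integral_congr fun t _ => ?_
  simp only [Complex.real_smul, Complex.ofReal_mul]
  rw [mul_comm (r : ℂ) t, mul_assoc, mul_div_assoc', mul_comm (t : ℂ) r, mul_div_mul_left _ _ hr']

/-- The singularity at `u = 0` is removable: the integrand is the difference quotient at `0` of `log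
(1 - u * c)`, and `dslope` is its continuous extension. -/
theorem intervalIntegrable_log_one_sub_mul_div {c : ℂ} {r : ℝ}
    (h : ∀ u ∈ Set.Icc 0 r, 1 - (u : ℂ) * c ∈ Complex.slitPlane) (hr : 0 < r) :
    IntervalIntegrable (fun u : ℝ => Complex.log (1 - u * c) / u) MeasureTheory.volume 0 r := by
  set f : ℝ → ℂ := fun u => Complex.log (1 - u * c) with hf
  have hlin : ∀ u : ℝ, HasDerivAt (fun u : ℝ => 1 - (u : ℂ) * c) (-(1 * c)) u := fun u =>
    ((Complex.ofRealCLM.hasDerivAt (x := u)).mul_const c).const_sub 1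
  have hd : ∀ u : ℝ, 1 - (u : ℂ) * c ∈ Complex.slitPlane → DifferentiableAt ℝ f u := fun u hu =>
    ((hlin u).clog_real hu).differentiableAt
  have h0 : 1 - ((0 : ℝ) : ℂ) * c ∈ Complex.slitPlane := by simp
  have hcont : ContinuousOn (dslope f 0) (Set.Icc 0 r) := by
    intro u hu
    rcases eq_or_ne u 0 with rfl | hu0
    · exact (continuousAt_dslope_same.2 (hd 0 h0)).continuousWithinAt
    · exact ((continuousAt_dslope_of_ne hu0).2 (hd u (h u hu)).continuousAt).continuousWithinAt
  have hint : IntervalIntegrable (dslope f 0) MeasureTheory.volume 0 r :=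
    ContinuousOn.intervalIntegrable (by rwa [Set.uIcc_of_le hr.le])
  refine hint.congr ?_
  rw [Set.uIoc_of_le hr.le]
  intro u hu
  rw [dslope_of_ne _ hu.1.ne', slope_def_module]
  simp only [hf, Complex.ofReal_zero, zero_mul, sub_zero, Complex.log_one, Complex.real_smul,
    Complex.ofReal_inv]
  rw [div_eq_inv_mul]

/-- After rescaling, `exp Z` is the upper limit of the integral, so the chain rule cancels the
denominator `u`. Continuity is needed only near that limit; hence the lemma also serves `c = 1`,
where the ray runs through the singularity `u = 1`. -/
theorem hasDerivAt_dilog_ray {c : ℂ} {Z : ℝ}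
    (hint : ∀ r : ℝ, 0 < r →
      IntervalIntegrable (fun u : ℝ => Complex.log (1 - u * c) / u) MeasureTheory.volume 0 r)
    (hcont : ∀ᶠ u in 𝓝 (Real.exp Z), ContinuousAt (fun u : ℝ => Complex.log (1 - u * c)) u) :
    HasDerivAt (fun Z : ℝ => dilog (Real.exp Z * c)) (-Complex.log (1 - Real.exp Z * c)) Z := by
  have he := Real.exp_pos Z
  have he' : (Real.exp Z : ℂ) ≠ 0 := by exact_mod_cast he.ne'
  have hev : ∀ᶠ u in 𝓝 (Real.exp Z),
      ContinuousAt (fun u : ℝ => Complex.log (1 - u * c) / u) u := by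
    filter_upwards [hcont, eventually_gt_nhds he] with u hu hu0
    exact hu.div Complex.continuous_ofReal.continuousAt (by exact_mod_cast hu0.ne')
  obtain ⟨s, hs, hso, hmem⟩ := eventually_nhds_iff.1 hev
  have hmeas : StronglyMeasurableAtFilter (fun u : ℝ => Complex.log (1 - u * c) / u)
      (𝓝 (Real.exp Z)) MeasureTheory.volume :=
    ContinuousAt.stronglyMeasurableAtFilter hso hs _ hmem
  have h1 := intervalIntegral.integral_hasDerivAt_right (hint _ he) hmeas hev.self_of_nhds
  have h2 := (h1.scomp Z (Real.hasDerivAt_exp Z)).neg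
  refine (h2.congr_of_eventuallyEq (Eventually.of_forall fun Z => ?_)).congr_deriv ?_
  · exact dilog_ofReal_mul (Real.exp_pos Z) c
  · rw [Complex.real_smul, mul_div_cancel₀ _ he']

theorem exp_line (Z θ : ℝ) :
    Complex.exp (Z + Complex.I * θ) = Real.exp Z * Complex.exp (Complex.I * θ) := by
  rw [Complex.exp_add, Complex.ofReal_exp]

theorem exp_line_im (Z θ : ℝ) : (Complex.exp (Z + Complex.I * θ)).im = Real.exp Z * Real.sin θ := by
  simp [Complex.exp_im]

theorem exp_I_mul_ne_one_of_sin_ne_zero {θ : ℝ} (h : Real.sin θ ≠ 0) :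
    Complex.exp (Complex.I * θ) ≠ 1 := fun h1 => h (by
  have := congrArg Complex.im h1
  simpa [Complex.exp_im] using this)

/-- The point can be real only if `u = 0` or `exp (iθ) = ±1`; the value `-1` gives `1 + u > 0`, so
`1` is the only bad direction. -/
theorem one_sub_ray_mem_slitPlane {θ : ℝ} (h : Complex.exp (Complex.I * θ) ≠ 1) {u : ℝ}
    (hu : 0 ≤ u) : 1 - (u : ℂ) * Complex.exp (Complex.I * θ) ∈ Complex.slitPlane := by
  rw [Complex.mem_slitPlane_iff]
  have hre : (1 - (u : ℂ) * Complex.exp (Complex.I * θ)).re = 1 - u * Real.cos θ := by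
    simp [Complex.exp_re]
  have him : (1 - (u : ℂ) * Complex.exp (Complex.I * θ)).im = -(u * Real.sin θ) := by
    simp [Complex.exp_im]
  rw [hre, him]
  rcases hu.eq_or_lt with rfl | hu
  · simp
  by_cases hs : Real.sin θ = 0
  · left
    rcases Real.sin_eq_zero_iff_cos_eq.1 hs with hc | hc
    · refine absurd ?_ h
      apply Complex.ext <;> simp [Complex.exp_re, Complex.exp_im, hs, hc]
    · rw [hc]
      linarith
  · right
    exact neg_ne_zero.2 (mul_ne_zero hu.ne' hs)

/-- `-arg (1 - exp (Z + iθ))`, the derivative of `Im Li₂ (exp (Z + iθ))`. -/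
noncomputable def rayArg (θ Z : ℝ) : ℝ := -(Complex.log (1 - Complex.exp (Z + Complex.I * θ))).im

theorem abs_rayArg_le_pi (θ Z : ℝ) : |rayArg θ Z| ≤ Real.pi := by
  rw [rayArg, abs_neg, Complex.log_im]
  exact Complex.abs_arg_le_pi _

theorem hasDerivAt_im_dilog {θ : ℝ} (h : Complex.exp (Complex.I * θ) ≠ 1) (Z : ℝ) :
    HasDerivAt (fun Z : ℝ => (dilog (Complex.exp (Z + Complex.I * θ))).im) (rayArg θ Z) Z := by
  have hlin : ∀ u : ℝ, ContinuousAt (fun u : ℝ => 1 - (u : ℂ) * Complex.exp (Complex.I * θ)) u :=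
    fun u => by fun_prop
  have := (hasDerivAt_dilog_ray (c := Complex.exp (Complex.I * θ)) (Z := Z)
    (fun r hr => intervalIntegrable_log_one_sub_mul_div
      (fun u hu => one_sub_ray_mem_slitPlane h hu.1) hr)
    (by
      filter_upwards [eventually_ge_nhds (Real.exp_pos Z)] with u hu
      exact (hlin u).clog (one_sub_ray_mem_slitPlane h hu))).complex_im
  simp only [exp_line, rayArg]
  simpa using this

/-- This formula is the source of all the convexity for (Q3) and (Q4): its sign is that of `sin θ`.
-/
theorem hasDerivAt_rayArg {θ : ℝ} (h : Complex.exp (Complex.I * θ) ≠ 1) (Z : ℝ) :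
    HasDerivAt (rayArg θ) (Real.exp Z * Real.sin θ
      / Complex.normSq (1 - Complex.exp (Z + Complex.I * θ))) Z := by
  have hs : 1 - Complex.exp (Z + Complex.I * θ) ∈ Complex.slitPlane := by
    rw [exp_line]
    exact one_sub_ray_mem_slitPlane h (Real.exp_pos Z).le
  have h1 : HasDerivAt (fun Z : ℝ => (Z : ℂ) + Complex.I * θ) 1 Z :=
    (Complex.ofRealCLM.hasDerivAt (x := Z)).add_const _
  have h2 := ((h1.cexp.const_sub 1).clog_real hs).complex_im.neg
  refine h2.congr_deriv ?_
  rw [Complex.div_im, ← exp_line_im]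
  have h0 : Complex.normSq (1 - Complex.exp (Z + Complex.I * θ)) ≠ 0 := by
    simpa using Complex.slitPlane_ne_zero hs
  field_simp
  simp
  ring

theorem continuous_rayArg {θ : ℝ} (h : Complex.exp (Complex.I * θ) ≠ 1) : Continuous (rayArg θ) :=
  continuous_iff_continuousAt.2 fun Z => (hasDerivAt_rayArg h Z).continuousAt

theorem normSq_one_sub_exp_line_pos {θ : ℝ} (h : Complex.exp (Complex.I * θ) ≠ 1) (Z : ℝ) :
    0 < Complex.normSq (1 - Complex.exp (Z + Complex.I * θ)) := by
  rw [Complex.normSq_pos, exp_line]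
  exact Complex.slitPlane_ne_zero (one_sub_ray_mem_slitPlane h (Real.exp_pos Z).le)

theorem strictMono_rayArg {θ : ℝ} (h : 0 < Real.sin θ) : StrictMono (rayArg θ) := by
  have h1 := exp_I_mul_ne_one_of_sin_ne_zero h.ne'
  exact strictMono_of_hasDerivAt_pos (hasDerivAt_rayArg h1) fun Z =>
    div_pos (mul_pos (Real.exp_pos Z) h) (normSq_one_sub_exp_line_pos h1 Z)

theorem strictAnti_rayArg {θ : ℝ} (h : Real.sin θ < 0) : StrictAnti (rayArg θ) := by
  have h1 := exp_I_mul_ne_one_of_sin_ne_zero h.ne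
  exact strictAnti_of_hasDerivAt_neg (hasDerivAt_rayArg h1) fun Z =>
    div_neg_of_neg_of_pos (mul_neg_of_pos_of_neg (Real.exp_pos Z) h)
      (normSq_one_sub_exp_line_pos h1 Z)

theorem hasDerivAt_imDilogSum_of {θ Z : ℝ}
    (h1 : HasDerivAt (fun Z : ℝ => (dilog (Complex.exp (Z + Complex.I * θ))).im) (rayArg θ Z) Z)
    (h2 : HasDerivAt (fun Z : ℝ => (dilog (Complex.exp (Z + Complex.I * θ))).im)
      (rayArg θ (-Z)) (-Z)) :
    HasDerivAt (fun Z => imDilogSum Z θ) (rayArg θ Z - rayArg θ (-Z)) Z := by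
  have h3 := h1.add (h2.scomp Z (hasDerivAt_neg Z))
  refine (h3.congr_of_eventuallyEq (Eventually.of_forall fun Z => ?_)).congr_deriv ?_
  · simp [imDilogSum]
  · simp [sub_eq_add_neg]

theorem hasDerivAt_imDilogSum {θ : ℝ} (h : Complex.exp (Complex.I * θ) ≠ 1) (Z : ℝ) :
    HasDerivAt (fun Z => imDilogSum Z θ) (rayArg θ Z - rayArg θ (-Z)) Z :=
  hasDerivAt_imDilogSum_of (hasDerivAt_im_dilog h Z) (hasDerivAt_im_dilog h (-Z))

theorem strictConvexOn_imDilogSum {θ : ℝ} (h : 0 < Real.sin θ) :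
    StrictConvexOn ℝ Set.univ fun Z => imDilogSum Z θ := by
  refine strictConvexOn_univ_of_hasDerivAt
    (hasDerivAt_imDilogSum (exp_I_mul_ne_one_of_sin_ne_zero h.ne')) fun Z Z' hZ => ?_
  have h1 := strictMono_rayArg h hZ
  have h2 := strictMono_rayArg h (neg_lt_neg hZ)
  linarith

theorem strictConvexOn_neg_imDilogSum {θ : ℝ} (h : Real.sin θ < 0) :
    StrictConvexOn ℝ Set.univ fun Z => -imDilogSum Z θ := by
  refine strictConvexOn_univ_of_hasDerivAt (fun Z =>
    (hasDerivAt_imDilogSum (exp_I_mul_ne_one_of_sin_ne_zero h.ne) Z).neg) fun Z Z' hZ => ?_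
  have h1 := strictAnti_rayArg h hZ
  have h2 := strictAnti_rayArg h (neg_lt_neg hZ)
  linarith

/-! ### The dilogarithm on the degenerate ray `exp (iθ) = 1` -/

theorem intervalIntegrable_log_one_sub_div {r : ℝ} (hr : 0 < r) :
    IntervalIntegrable (fun u : ℝ => Complex.log (1 - u * 1) / u) MeasureTheory.volume 0 r := by
  have h1 : IntervalIntegrable (fun u : ℝ => Complex.log (1 - u * 1) / u)
      MeasureTheory.volume 0 (1 / 2) := by
    refine intervalIntegrable_log_one_sub_mul_div (fun u hu => ?_) (by norm_num)
    rw [Complex.mem_slitPlane_iff]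
    left
    have := hu.2
    simp
    linarith
  -- At `u = 1` the real part `log |1 - u|` is still integrable, and the imaginary part is bounded
  -- by `π`.
  have hlog : ∀ a b : ℝ, IntervalIntegrable (fun u : ℝ => Complex.log (1 - u * 1))
      MeasureTheory.volume a b := by
    intro a b
    have hre : IntervalIntegrable (fun u : ℝ => ((Real.log (1 - u) : ℝ) : ℂ))
        MeasureTheory.volume a b := by
      have := (intervalIntegral.intervalIntegrable_log' (a := 1 - a) (b := 1 - b)).comp_sub_left 1
      simp only [sub_sub_cancel] at this
      exact ⟨this.1.ofReal, this.2.ofReal⟩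
    have him : IntervalIntegrable (fun u : ℝ => (((Complex.log (1 - u * 1)).im : ℝ) : ℂ))
        MeasureTheory.volume a b := by
      rw [intervalIntegrable_iff]
      refine MeasureTheory.Measure.integrableOn_of_bounded (M := Real.pi) (by simp) ?_ ?_
      · refine Measurable.aestronglyMeasurable ?_
        fun_prop
      · refine Eventually.of_forall fun u => ?_
        simp only [Complex.norm_real, Real.norm_eq_abs, Complex.log_im]
        exact Complex.abs_arg_le_pi _
    refine (hre.add (him.mul_const Complex.I)).congr fun u _ => ?_
    apply Complex.ext
    · have : (1 - (u : ℂ)) = ((1 - u : ℝ) : ℂ) := by simp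
      simp only [mul_one, this, Complex.log_ofReal_re]
      simp
    · simp
  rcases le_total r (1 / 2) with h | h
  · exact h1.mono_set (Set.uIcc_subset_uIcc_left (by rw [Set.mem_uIcc]; left; exact ⟨hr.le, h⟩))
  · refine h1.trans ?_
    have := (hlog (1 / 2) r).mul_continuousOn (g := fun u : ℝ => (u : ℂ)⁻¹) ?_
    · simpa only [div_eq_mul_inv] using this
    · refine ContinuousOn.inv₀ (Complex.continuous_ofReal.continuousOn) fun u hu => ?_
      rw [Set.uIcc_of_le h] at hu
      have : 0 < u := lt_of_lt_of_le (by norm_num) hu.1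
      exact_mod_cast this.ne'

/-- For `u > 1` the values lie on the branch cut, but along the real line the imaginary part is
constantly `π`. -/
theorem continuousAt_log_one_sub {u : ℝ} (hu : u ≠ 1) :
    ContinuousAt (fun u : ℝ => Complex.log (1 - u * 1)) u := by
  simp only [mul_one]
  rcases hu.lt_or_gt with h | h
  · have hlin : ContinuousAt (fun u : ℝ => 1 - (u : ℂ)) u := by fun_prop
    refine hlin.clog ?_
    rw [Complex.mem_slitPlane_iff]
    left
    simpa using h
  · have hlin : ContinuousAt (fun u : ℝ => Complex.log ((u : ℂ) - 1) + Real.pi * Complex.I) u := by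
      refine ContinuousAt.add (ContinuousAt.clog (by fun_prop) ?_) continuousAt_const
      rw [Complex.mem_slitPlane_iff]
      left
      simpa using h
    refine hlin.congr ?_
    filter_upwards [eventually_gt_nhds h] with v hv
    have e1 : (1 : ℂ) - v = -((v - 1 : ℝ) : ℂ) := by simp
    have e2 : (v : ℂ) - 1 = ((v - 1 : ℝ) : ℂ) := by simp
    have hv' : 0 < v - 1 := by linarith
    rw [e1, e2, Complex.log, Complex.log, norm_neg, Complex.arg_ofReal_of_nonneg hv'.le,
      ← Complex.ofReal_neg, Complex.arg_ofReal_of_neg (by linarith)]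
    simp

theorem hasDerivAt_im_dilog_of_eq_one {θ Z : ℝ} (h : Complex.exp (Complex.I * θ) = 1) (hZ : Z ≠ 0) :
    HasDerivAt (fun Z : ℝ => (dilog (Complex.exp (Z + Complex.I * θ))).im) (rayArg θ Z) Z := by
  have := (hasDerivAt_dilog_ray (c := 1) (Z := Z)
    (fun r hr => intervalIntegrable_log_one_sub_div hr) (by
      filter_upwards [isOpen_ne.mem_nhds (show Real.exp Z ≠ 1 by simpa using hZ)] with u hu
      exact continuousAt_log_one_sub hu)).complex_im
  simp only [exp_line, rayArg, h]
  simpa using this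

theorem rayArg_of_eq_one_of_neg {θ Z : ℝ} (h : Complex.exp (Complex.I * θ) = 1) (hZ : Z < 0) :
    rayArg θ Z = 0 := by
  have : (1 : ℂ) - Real.exp Z * 1 = ((1 - Real.exp Z : ℝ) : ℂ) := by simp
  rw [rayArg, exp_line, h, this, Complex.log_im, Complex.arg_ofReal_of_nonneg, neg_zero]
  have := Real.exp_lt_one_iff.2 hZ
  linarith

theorem rayArg_of_eq_one_of_pos {θ Z : ℝ} (h : Complex.exp (Complex.I * θ) = 1) (hZ : 0 < Z) :
    rayArg θ Z = -Real.pi := by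
  have : (1 : ℂ) - Real.exp Z * 1 = ((1 - Real.exp Z : ℝ) : ℂ) := by simp
  rw [rayArg, exp_line, h, this, Complex.log_im, Complex.arg_ofReal_of_neg]
  have := Real.one_lt_exp_iff.2 hZ
  linarith

/-- All `θ` are needed, since in the converse the labels of the other edges are arbitrary. The
function is a step function off `0` if `exp (iθ) = 1`, and bounded monotone otherwise. -/
theorem exists_tendsto_rayArg (θ : ℝ) :
    (∃ l, Tendsto (rayArg θ) atTop (𝓝 l)) ∧ ∃ l, Tendsto (rayArg θ) atBot (𝓝 l) := by
  by_cases h : Complex.exp (Complex.I * θ) = 1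
  · refine ⟨⟨-Real.pi, tendsto_const_nhds.congr' ?_⟩, 0, tendsto_const_nhds.congr' ?_⟩
    · filter_upwards [eventually_gt_atTop 0] with Z hZ
      exact (rayArg_of_eq_one_of_pos h hZ).symm
    · filter_upwards [eventually_lt_atBot 0] with Z hZ
      exact (rayArg_of_eq_one_of_neg h hZ).symm
  · rcases le_total 0 (Real.sin θ) with hs | hs
    · exact (monotone_of_hasDerivAt_nonneg (hasDerivAt_rayArg h) fun Z =>
        div_nonneg (mul_nonneg (Real.exp_pos Z).le hs)
          (Complex.normSq_nonneg _)).exists_tendsto_atTop_atBot (abs_rayArg_le_pi θ)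
    · obtain ⟨⟨l, hl⟩, l', hl'⟩ := (antitone_of_hasDerivAt_nonpos (hasDerivAt_rayArg h) fun Z =>
        div_nonpos_of_nonpos_of_nonneg (mul_nonpos_of_nonneg_of_nonpos (Real.exp_pos Z).le hs)
          (Complex.normSq_nonneg _)).neg.exists_tendsto_atTop_atBot (M := Real.pi)
          (by simpa using abs_rayArg_le_pi θ)
      exact ⟨⟨-l, by simpa using hl.neg⟩, -l', by simpa using hl'.neg⟩

theorem secondDiffVanishes_imDilogSum (θ : ℝ) : SecondDiffVanishes fun Z => imDilogSum Z θ := by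
  obtain ⟨⟨l, hl⟩, l', hl'⟩ := exists_tendsto_rayArg θ
  refine .of_hasDerivAt (f' := fun Z => rayArg θ Z - rayArg θ (-Z)) ?_
    (hl.sub (hl'.comp tendsto_neg_atTop_atBot)) (hl'.sub (hl.comp tendsto_neg_atBot_atTop))
  by_cases h : Complex.exp (Complex.I * θ) = 1
  · have key : ∀ Z : ℝ, Z ≠ 0 →
        HasDerivAt (fun Z => imDilogSum Z θ) (rayArg θ Z - rayArg θ (-Z)) Z := fun Z hZ =>
      hasDerivAt_imDilogSum_of (hasDerivAt_im_dilog_of_eq_one h hZ)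
        (hasDerivAt_im_dilog_of_eq_one h (neg_ne_zero.2 hZ))
    rw [eventually_sup]
    constructor
    · filter_upwards [eventually_lt_atBot 0] with Z hZ using key Z hZ.ne
    · filter_upwards [eventually_gt_atTop 0] with Z hZ using key Z hZ.ne'
  · exact Eventually.of_forall (hasDerivAt_imDilogSum h)

/-! ### The Jacobi triple product -/

/-- Gaussian binomial coefficients. -/
def gaussBinom {R : Type*} [CommRing R] (p : R) : ℕ → ℕ → R
  | _, 0 => 1
  | 0, _ + 1 => 0
  | m + 1, j + 1 => gaussBinom p m j + p ^ (j + 1) * gaussBinom p m (j + 1)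

/-- The finite product `∏_{k=1}^m (1 - p ^ k)`. -/
def qFactorial {R : Type*} [CommRing R] (p : R) (m : ℕ) : R :=
  ∏ k ∈ Finset.range m, (1 - p ^ (k + 1))

section GaussBinom

variable {R : Type*} [CommRing R] (p : R)

@[simp] theorem gaussBinom_zero_right (m : ℕ) : gaussBinom p m 0 = 1 := by
  cases m <;> rfl

theorem gaussBinom_succ_succ (m j : ℕ) : gaussBinom p (m + 1) (j + 1)
    = gaussBinom p m j + p ^ (j + 1) * gaussBinom p m (j + 1) := rfl

theorem gaussBinom_eq_zero {m j : ℕ} (h : m < j) : gaussBinom p m j = 0 := by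
  induction m generalizing j with
  | zero =>
    obtain ⟨j, rfl⟩ := Nat.exists_eq_succ_of_ne_zero h.ne'
    rfl
  | succ m ih =>
    obtain ⟨j, rfl⟩ := Nat.exists_eq_succ_of_ne_zero (Nat.ne_zero_of_lt h)
    rw [Nat.succ_eq_add_one, gaussBinom_succ_succ, ih (by omega), ih (by omega)]
    simp

/-- The finite `q`-binomial theorem. -/
theorem prod_one_add_mul_pow (x : R) (m : ℕ) : ∏ k ∈ Finset.range m, (1 + x * p ^ k)
    = ∑ j ∈ Finset.range (m + 1), p ^ (j.choose 2) * x ^ j * gaussBinom p m j := by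
  induction m generalizing x with
  | zero => simp
  | succ m ih =>
    -- Splitting off the factor `k = 0` leaves the same product at `x * p`, which is why the
    -- induction runs over all `x`.
    have h1 : ∏ k ∈ Finset.range (m + 1), (1 + x * p ^ k)
        = (∏ k ∈ Finset.range m, (1 + (x * p) * p ^ k)) * (1 + x) := by
      rw [Finset.prod_range_succ']
      congr 1
      · exact Finset.prod_congr rfl fun k _ => by ring
      · simp
    have h2 : ∑ j ∈ Finset.range (m + 1), p ^ (j.choose 2) * (x * p) ^ j * gaussBinom p m j
        = ∑ j ∈ Finset.range (m + 1),
          p ^ ((j + 1).choose 2) * (x * p) ^ (j + 1) * gaussBinom p m (j + 1) + 1 := by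
      have := Finset.sum_range_succ'
        (fun j => p ^ (j.choose 2) * (x * p) ^ j * gaussBinom p m j) (m + 1)
      rw [Finset.sum_range_succ, gaussBinom_eq_zero p (Nat.lt_succ_self m)] at this
      simpa using this
    rw [h1, ih, mul_add, mul_one, Finset.sum_range_succ' _ (m + 1)]
    nth_rw 1 [h2]
    rw [Finset.sum_mul, add_right_comm, ← Finset.sum_add_distrib]
    simp only [gaussBinom_zero_right, Nat.choose_zero_succ, pow_zero, mul_one]
    congr 1
    refine Finset.sum_congr rfl fun j _ => ?_
    rw [gaussBinom_succ_succ, Nat.choose_succ_succ' j 1, Nat.choose_one_right]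
    ring

theorem gaussBinom_mul_qFactorial (i j : ℕ) :
    gaussBinom p (i + j) j * (qFactorial p j * qFactorial p i) = qFactorial p (i + j) := by
  induction i generalizing j with
  | zero =>
    induction j with
    | zero => simp [qFactorial]
    | succ j ih =>
      rw [zero_add] at ih ⊢
      rw [gaussBinom_succ_succ, gaussBinom_eq_zero p (Nat.lt_succ_self j), mul_zero, add_zero]
      simp only [qFactorial, Finset.prod_range_succ, Finset.prod_range_zero, mul_one] at ih ⊢
      linear_combination (1 - p ^ (j + 1)) * ih
  | succ i ih =>
    induction j with
    | zero => simp [qFactorial]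
    | succ j ihj =>
      have h1 := ih (j + 1)
      have h3 : qFactorial p (i + 1 + (j + 1))
          = qFactorial p (i + (j + 1)) * (1 - p ^ (i + 1) * p ^ (j + 1)) := by
        rw [← pow_add, show i + 1 + (j + 1) = i + (j + 1) + 1 by ring, qFactorial,
          Finset.prod_range_succ]
        congr 3
      have h4 : qFactorial p (j + 1) = qFactorial p j * (1 - p ^ (j + 1)) :=
        Finset.prod_range_succ _ _
      have h5 : qFactorial p (i + 1) = qFactorial p i * (1 - p ^ (i + 1)) :=
        Finset.prod_range_succ _ _
      rw [show i + 1 + j = i + (j + 1) by ring] at ihj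
      rw [h3, show i + 1 + (j + 1) = i + (j + 1) + 1 by ring, gaussBinom_succ_succ]
      rw [h4] at h1 ⊢
      rw [h5] at ihj ⊢
      -- The two weights add up to `1 - p ^ (i + 1) * p ^ (j + 1)`, the new factor of the right-hand
      -- side.
      linear_combination (1 - p ^ (j + 1)) * ihj + p ^ (j + 1) * (1 - p ^ (i + 1)) * h1

end GaussBinom

section TripleProduct

variable {K : Type*} [Field K]

/-- The exponents of `q` are the odd numbers from `1 - 2N` to `2N - 1`. The positive ones give the
factors with `z`; from each negative one `z q^(-(2k+1))` is extracted, leaving a factor with `z⁻¹`.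
The extracted powers multiply to `q^(-N²)`. -/
theorem prod_range_two_mul_symm (q z : K) (hq : q ≠ 0) (hz : z ≠ 0) (N : ℕ) :
    ∏ k ∈ Finset.range (2 * N), (1 + z * q ^ (1 - 2 * (N : ℤ)) * (q ^ 2) ^ k)
      = z ^ N * (q ^ (N ^ 2))⁻¹
        * ∏ k ∈ Finset.range N, ((1 + q ^ (2 * k + 1) * z) * (1 + q ^ (2 * k + 1) * z⁻¹)) := by
  rw [two_mul, Finset.prod_range_add, ← Finset.prod_range_reflect, Finset.prod_mul_distrib]
  have h1 : ∏ j ∈ Finset.range N, (1 + z * q ^ (1 - 2 * (N : ℤ)) * (q ^ 2) ^ (N - 1 - j))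
      = z ^ N * (q ^ (N ^ 2))⁻¹ * ∏ k ∈ Finset.range N, (1 + q ^ (2 * k + 1) * z⁻¹) := by
    have hsum : ∏ k ∈ Finset.range N, (z * (q ^ (2 * k + 1))⁻¹) = z ^ N * (q ^ (N ^ 2))⁻¹ := by
      rw [Finset.prod_mul_distrib, Finset.prod_const, Finset.card_range, Finset.prod_inv_distrib,
        Finset.prod_pow_eq_pow_sum]
      congr 3
      clear * -
      induction N with
      | zero => simp
      | succ N ih => rw [Finset.sum_range_succ, ih]; ring
    rw [← hsum, ← Finset.prod_mul_distrib]
    refine Finset.prod_congr rfl fun k hk => ?_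
    have hk' : k < N := Finset.mem_range.1 hk
    have e : q ^ (1 - 2 * (N : ℤ)) * (q ^ 2) ^ (N - 1 - k) = (q ^ (2 * k + 1))⁻¹ := by
      rw [← pow_mul, ← zpow_natCast q (2 * (N - 1 - k)), ← zpow_add₀ hq, ← zpow_natCast q,
        ← zpow_neg]
      congr 1
      omega
    rw [mul_assoc, e]
    have hq' : q ^ (2 * k + 1) ≠ 0 := pow_ne_zero _ hq
    field_simp
    ring
  have h2 : ∏ k ∈ Finset.range N, (1 + z * q ^ (1 - 2 * (N : ℤ)) * (q ^ 2) ^ (N + k))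
      = ∏ k ∈ Finset.range N, (1 + q ^ (2 * k + 1) * z) := by
    refine Finset.prod_congr rfl fun k hk => ?_
    have e : q ^ (1 - 2 * (N : ℤ)) * (q ^ 2) ^ (N + k) = q ^ (2 * k + 1) := by
      rw [← pow_mul, ← zpow_natCast q (2 * (N + k)), ← zpow_add₀ hq, ← zpow_natCast q]
      congr 1
      push_cast
      ring
    rw [mul_assoc, e, mul_comm z]
  rw [h1, h2]
  ring

/-- The finite form of the Jacobi triple product. -/
theorem finite_triple_product (q z : K) (hq : q ≠ 0) (hz : z ≠ 0) (N : ℕ) :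
    ∏ k ∈ Finset.range N, ((1 + q ^ (2 * k + 1) * z) * (1 + q ^ (2 * k + 1) * z⁻¹))
      = ∑ j ∈ Finset.range (2 * N + 1), q ^ (((j : ℤ) - N) ^ 2) * z ^ ((j : ℤ) - N)
        * gaussBinom (q ^ 2) (2 * N) j := by
  have h := prod_range_two_mul_symm q z hq hz N
  rw [prod_one_add_mul_pow] at h
  have hc : z ^ N * (q ^ (N ^ 2))⁻¹ ≠ 0 :=
    mul_ne_zero (pow_ne_zero _ hz) (inv_ne_zero (pow_ne_zero _ hq))
  apply mul_left_cancel₀ hc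
  rw [← h, Finset.mul_sum]
  refine Finset.sum_congr rfl fun j _ => ?_
  rw [← mul_assoc]
  congr 1
  have e1 : (q ^ 2) ^ (j.choose 2) = q ^ ((j : ℤ) * (j - 1)) := by
    rw [← pow_mul, mul_comm, Nat.choose_two_right, Nat.div_mul_cancel (Nat.even_mul_pred_self j).two_dvd,
      ← zpow_natCast]
    congr 1
    cases j <;> simp
  have e2 : (z * q ^ (1 - 2 * (N : ℤ))) ^ j = z ^ (j : ℤ) * q ^ ((1 - 2 * (N : ℤ)) * j) := by
    rw [mul_pow, zpow_mul, zpow_natCast, zpow_natCast]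
  rw [e1, e2, ← zpow_natCast z, ← zpow_natCast q, ← zpow_neg]
  have e3 : z ^ (N : ℤ) * q ^ (-((N ^ 2 : ℕ) : ℤ)) * (q ^ (((j : ℤ) - N) ^ 2) * z ^ ((j : ℤ) - N))
      = (z ^ (N : ℤ) * z ^ ((j : ℤ) - N)) * (q ^ (-((N ^ 2 : ℕ) : ℤ)) * q ^ (((j : ℤ) - N) ^ 2)) := by
    ring
  rw [e3, ← zpow_add₀ hz, ← zpow_add₀ hq, mul_left_comm, ← zpow_add₀ hq]
  congr 2
  · ring
  · push_cast
    ring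

end TripleProduct

theorem summable_norm_pow_succ {p : ℂ} (hp : ‖p‖ < 1) : Summable fun k : ℕ => ‖-p ^ (k + 1)‖ := by
  simpa using (summable_nat_add_iff 1).2 (summable_geometric_of_lt_one (norm_nonneg p) hp)

theorem one_sub_pow_succ_ne_zero {p : ℂ} (hp : ‖p‖ < 1) (k : ℕ) : 1 - p ^ (k + 1) ≠ 0 := by
  intro h
  have h1 : ‖p ^ (k + 1)‖ = 1 := by rw [← sub_eq_zero.1 h, norm_one]
  rw [norm_pow] at h1
  exact (pow_lt_one₀ (norm_nonneg p) hp (Nat.succ_ne_zero k)).ne h1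

theorem exists_tendsto_qFactorial {p : ℂ} (hp : ‖p‖ < 1) :
    ∃ c ≠ 0, Tendsto (qFactorial p) atTop (𝓝 c) := by
  refine ⟨∏' k : ℕ, (1 + -p ^ (k + 1)), tprod_one_add_ne_zero_of_summable (fun k => ?_)
    (summable_norm_pow_succ hp), ?_⟩
  · simpa [sub_eq_add_neg] using one_sub_pow_succ_ne_zero hp k
  · have := (multipliable_one_add_of_summable (summable_norm_pow_succ hp)).hasProd.tendsto_prod_nat
    refine this.congr fun m => ?_
    simp only [qFactorial, sub_eq_add_neg]

theorem qFactorial_ne_zero {p : ℂ} (hp : ‖p‖ < 1) (m : ℕ) : qFactorial p m ≠ 0 :=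
  Finset.prod_ne_zero_iff.2 fun k _ => one_sub_pow_succ_ne_zero hp k

/-- The central Gaussian binomial coefficients, indexed from the middle and extended by zero. -/
noncomputable def centralGaussBinom (p : ℂ) (N : ℕ) (n : ℤ) : ℂ :=
  if n ∈ Finset.Icc (-(N : ℤ)) N then gaussBinom p (2 * N) (n + N).toNat else 0

theorem centralGaussBinom_eq {p : ℂ} (hp : ‖p‖ < 1) {N : ℕ} {n : ℤ}
    (hn : n ∈ Finset.Icc (-(N : ℤ)) N) : centralGaussBinom p N n = qFactorial p (2 * N)
      * ((qFactorial p (n + N).toNat)⁻¹ * (qFactorial p (N - n).toNat)⁻¹) := by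
  rw [centralGaussBinom, if_pos hn]
  rw [Finset.mem_Icc] at hn
  have h := gaussBinom_mul_qFactorial p (N - n).toNat (n + N).toNat
  rw [show (N - n).toNat + (n + N).toNat = 2 * N by omega] at h
  have h1 := qFactorial_ne_zero hp (n + N).toNat
  have h2 := qFactorial_ne_zero hp (N - n).toNat
  rw [← h]
  field_simp

/-- Each nonzero value is a product of terms from the convergent sequences `qFactorial p` and its
inverse. The uniform bound provides the majorant for dominated convergence. -/
theorem exists_norm_centralGaussBinom_le {p : ℂ} (hp : ‖p‖ < 1) :
    ∃ B, ∀ N n, ‖centralGaussBinom p N n‖ ≤ B := by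
  obtain ⟨c, hc, hlim⟩ := exists_tendsto_qFactorial hp
  obtain ⟨B₁, h₁⟩ := (Metric.isBounded_range_of_tendsto _ hlim).exists_norm_le
  obtain ⟨B₂, h₂⟩ := (Metric.isBounded_range_of_tendsto _ (hlim.inv₀ hc)).exists_norm_le
  have h₁' : ∀ m, ‖qFactorial p m‖ ≤ B₁ := fun m => h₁ _ ⟨m, rfl⟩
  have h₂' : ∀ m, ‖(qFactorial p m)⁻¹‖ ≤ B₂ := fun m => h₂ _ ⟨m, rfl⟩
  have hB₁ : 0 ≤ B₁ := (norm_nonneg _).trans (h₁' 0)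
  have hB₂ : 0 ≤ B₂ := (norm_nonneg _).trans (h₂' 0)
  refine ⟨B₁ * (B₂ * B₂), fun N n => ?_⟩
  by_cases hn : n ∈ Finset.Icc (-(N : ℤ)) N
  · rw [centralGaussBinom_eq hp hn, norm_mul, norm_mul]
    gcongr
    exacts [h₁' _, h₂' _, h₂' _]
  · rw [centralGaussBinom, if_neg hn, norm_zero]
    positivity

theorem tendsto_centralGaussBinom {p c : ℂ} (hp : ‖p‖ < 1) (hc : c ≠ 0)
    (hlim : Tendsto (qFactorial p) atTop (𝓝 c)) (n : ℤ) :
    Tendsto (fun N => centralGaussBinom p N n) atTop (𝓝 c⁻¹) := by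
  have h1 : Tendsto (fun N : ℕ => 2 * N) atTop atTop :=
    tendsto_id.const_mul_atTop' two_pos
  have h2 : Tendsto (fun N : ℕ => (n + N).toNat) atTop atTop :=
    tendsto_atTop.2 fun b => by
      filter_upwards [eventually_ge_atTop (b + n.natAbs)] with N hN
      omega
  have h3 : Tendsto (fun N : ℕ => (N - n).toNat) atTop atTop :=
    tendsto_atTop.2 fun b => by
      filter_upwards [eventually_ge_atTop (b + n.natAbs)] with N hN
      omega
  have h4 := (hlim.comp h1).mul (((hlim.comp h2).inv₀ hc).mul ((hlim.comp h3).inv₀ hc))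
  rw [mul_inv_cancel_left₀ hc] at h4
  refine h4.congr' ?_
  filter_upwards [eventually_ge_atTop n.natAbs] with N hN
  rw [centralGaussBinom_eq hp (Finset.mem_Icc.2 (by omega))]
  rfl

theorem finite_triple_product_tsum {q z : ℂ} (hq : q ≠ 0) (hz : z ≠ 0) (N : ℕ) :
    ∏ k ∈ Finset.range N, ((1 + q ^ (2 * k + 1) * z) * (1 + q ^ (2 * k + 1) * z⁻¹))
      = ∑' n : ℤ, q ^ (n ^ 2) * z ^ n * centralGaussBinom (q ^ 2) N n := by
  rw [finite_triple_product q z hq hz, tsum_eq_sum (s := Finset.Icc (-(N : ℤ)) N)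
    (fun n hn => by rw [centralGaussBinom, if_neg hn, mul_zero])]
  refine Finset.sum_bij' (fun j _ => (j : ℤ) - N) (fun n _ => (n + N).toNat)
    (fun j hj => ?_) (fun n hn => ?_) (fun j hj => ?_) (fun n hn => ?_) (fun j hj => ?_)
  · rw [Finset.mem_range] at hj
    exact Finset.mem_Icc.2 (by omega)
  · rw [Finset.mem_Icc] at hn
    exact Finset.mem_range.2 (by omega)
  · simp
  · rw [Finset.mem_Icc] at hn
    omega
  · rw [Finset.mem_range] at hj
    rw [centralGaussBinom, if_pos (Finset.mem_Icc.2 (by omega))]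
    congr 2
    omega

theorem jacobiTheta₂_term_eq_zpow (n : ℤ) (v τ : ℂ) : jacobiTheta₂_term n v τ
    = Complex.exp (Real.pi * Complex.I * τ) ^ (n ^ 2) * Complex.exp (2 * Real.pi * Complex.I * v) ^ n := by
  rw [jacobiTheta₂_term, ← Complex.exp_int_mul, ← Complex.exp_int_mul, ← Complex.exp_add]
  congr 1
  push_cast
  ring

/-- The Jacobi triple product, up to the value of the constant. -/
theorem exists_tendsto_triple_product {τ : ℂ} (hτ : 0 < τ.im) : ∃ c : ℂ, c ≠ 0 ∧ ∀ v : ℂ,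
    Tendsto (fun N => ∏ k ∈ Finset.range N,
      ((1 + Complex.exp (Real.pi * Complex.I * τ) ^ (2 * k + 1)
          * Complex.exp (2 * Real.pi * Complex.I * v))
        * (1 + Complex.exp (Real.pi * Complex.I * τ) ^ (2 * k + 1)
          * (Complex.exp (2 * Real.pi * Complex.I * v))⁻¹)))
      atTop (𝓝 (jacobiTheta₂ v τ * c)) := by
  set q := Complex.exp (Real.pi * Complex.I * τ) with hq
  have hq1 : ‖q ^ 2‖ < 1 := by
    rw [norm_pow]
    refine pow_lt_one₀ (norm_nonneg _) ?_ two_ne_zero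
    rw [hq, Complex.norm_exp, Real.exp_lt_one_iff]
    simpa using mul_pos Real.pi_pos hτ
  obtain ⟨c, hc, hlim⟩ := exists_tendsto_qFactorial hq1
  obtain ⟨B, hB⟩ := exists_norm_centralGaussBinom_le hq1
  -- The constant is independent of `v`, so its value never matters: it cancels from theta
  -- quotients.
  refine ⟨c⁻¹, inv_ne_zero hc, fun v => ?_⟩
  have hsum := (summable_jacobiTheta₂_term_iff v τ).2 hτ
  refine Tendsto.congr (fun N => (finite_triple_product_tsum (Complex.exp_ne_zero _)
    (Complex.exp_ne_zero _) N).symm) ?_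
  rw [jacobiTheta₂, ← tsum_mul_right]
  refine tendsto_tsum_of_dominated_convergence (bound := fun n => ‖jacobiTheta₂_term n v τ‖ * B)
    (hsum.norm.mul_right B) (fun n => ?_) (Eventually.of_forall fun N n => ?_)
  · rw [jacobiTheta₂_term_eq_zpow]
    exact (tendsto_centralGaussBinom hq1 hc hlim n).const_mul _
  · rw [← jacobiTheta₂_term_eq_zpow, norm_mul]
    exact mul_le_mul_of_nonneg_left (hB N n) (norm_nonneg _)

theorem jacobiTheta₂_ne_zero {τ v : ℂ} (hτ : 0 < τ.im)
    (h1 : ∀ k : ℕ, 1 + Complex.exp (Real.pi * Complex.I * τ) ^ (2 * k + 1)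
      * Complex.exp (2 * Real.pi * Complex.I * v) ≠ 0)
    (h2 : ∀ k : ℕ, 1 + Complex.exp (Real.pi * Complex.I * τ) ^ (2 * k + 1)
      * (Complex.exp (2 * Real.pi * Complex.I * v))⁻¹ ≠ 0) : jacobiTheta₂ v τ ≠ 0 := by
  obtain ⟨c, -, hlim⟩ := exists_tendsto_triple_product hτ
  have hq1 : ‖Complex.exp (Real.pi * Complex.I * τ)‖ < 1 := by
    rw [Complex.norm_exp, Real.exp_lt_one_iff]
    simpa using mul_pos Real.pi_pos hτ
  have hs : ∀ w : ℂ, Summable fun k : ℕ =>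
      ‖Complex.exp (Real.pi * Complex.I * τ) ^ (2 * k + 1) * w‖ := by
    intro w
    have hg := summable_geometric_of_lt_one (norm_nonneg _) hq1
    have := (hg.comp_injective (i := fun k : ℕ => 2 * k + 1) (fun a b h => by simpa using h))
    simpa [norm_mul, norm_pow, Function.comp_def] using this.mul_right ‖w‖
  have hp : ∀ w : ℂ, (∀ k : ℕ, 1 + Complex.exp (Real.pi * Complex.I * τ) ^ (2 * k + 1) * w ≠ 0) →
      ∃ l ≠ 0, Tendsto (fun N => ∏ k ∈ Finset.range N,
        (1 + Complex.exp (Real.pi * Complex.I * τ) ^ (2 * k + 1) * w)) atTop (𝓝 l) := fun w hw =>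
    ⟨_, tprod_one_add_ne_zero_of_summable hw (hs w),
      (multipliable_one_add_of_summable (hs w)).hasProd.tendsto_prod_nat⟩
  obtain ⟨l₁, hl₁, ht₁⟩ := hp _ h1
  obtain ⟨l₂, hl₂, ht₂⟩ := hp _ h2
  have := hlim v
  simp only [Finset.prod_mul_distrib] at this
  have he := tendsto_nhds_unique this (ht₁.mul ht₂)
  intro h0
  rw [h0, zero_mul] at he
  exact mul_ne_zero hl₁ hl₂ he.symm

/-! ### The theta functions `ϑ₁`, `ϑ₄` in terms of the two-variable theta function -/

theorem exp_pi_mul_I_int (n : ℤ) : Complex.exp (n * (Real.pi * Complex.I)) = (-1) ^ n := by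
  rw [Complex.exp_int_mul, Complex.exp_pi_mul_I]

theorem tsum_int_eq_zero_add_tsum_nat {f : ℤ → ℂ} (hf : Summable f) :
    ∑' n, f n = f 0 + ∑' n : ℕ, (f (n + 1) + f (-(n + 1))) := by
  have h1 : Summable fun n : ℕ => f n := hf.comp_injective Nat.cast_injective
  have h2 : Summable fun n : ℕ => f (-(n + 1)) :=
    hf.comp_injective (i := fun n : ℕ => -((n : ℤ) + 1)) fun a b h => by simpa using h
  have h3 : Summable fun n : ℕ => f (n + 1) :=
    hf.comp_injective (i := fun n : ℕ => (n : ℤ) + 1) fun a b h => by simpa using h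
  rw [tsum_of_nat_of_neg_add_one h1 h2, h1.tsum_eq_zero_add, add_assoc, h3.tsum_add h2]
  simp

/-- The shift by `1 / 2` produces the signs `(-1) ^ n`, and pairing `n + 1` with `-(n + 1)` produces
the cosines. -/
theorem thetaFour_eq {τ : ℂ} (hτ : 0 < τ.im) (v : ℂ) :
    thetaFour τ v = jacobiTheta₂ (v / Real.pi + 1 / 2) τ := by
  have hsum := (summable_jacobiTheta₂_term_iff (v / Real.pi + 1 / 2) τ).2 hτ
  have hpi : (Real.pi : ℂ) ≠ 0 := Complex.ofReal_ne_zero.2 Real.pi_ne_zero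
  have hterm : ∀ n : ℤ, jacobiTheta₂_term n (v / Real.pi + 1 / 2) τ
      = (-1) ^ n * Complex.exp (Complex.I * Real.pi * τ * n ^ 2) * Complex.exp (2 * n * v * Complex.I) := by
    intro n
    rw [jacobiTheta₂_term, ← exp_pi_mul_I_int, ← Complex.exp_add, ← Complex.exp_add]
    congr 1
    field_simp
    ring
  rw [jacobiTheta₂, tsum_int_eq_zero_add_tsum_nat hsum, thetaFour, ← tsum_mul_left]
  congr 1
  · simp [jacobiTheta₂_term]
  · refine tsum_congr fun n => ?_
    have e : (-1 : ℂ) ^ ((n : ℤ) + 1) = (-1) ^ (n + 1) := by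
      rw [← Nat.cast_succ, zpow_natCast]
    rw [hterm, hterm, Complex.cos, zpow_neg, ← inv_zpow, inv_neg_one, e]
    push_cast
    ring_nf

/-- The shift by `τ / 2` and the prefactors complete the square to `(n + 1 / 2) ^ 2`; pairing `n`
with `-(n + 1)` produces the sines. -/
theorem thetaOne_eq {τ : ℂ} (hτ : 0 < τ.im) (v : ℂ) :
    thetaOne τ v = -Complex.I * Complex.exp (Complex.I * Real.pi * τ / 4)
      * Complex.exp (Complex.I * v) * jacobiTheta₂ (v / Real.pi + τ / 2 + 1 / 2) τ := by
  have hsum := (summable_jacobiTheta₂_term_iff (v / Real.pi + τ / 2 + 1 / 2) τ).2 hτ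
  have hpi : (Real.pi : ℂ) ≠ 0 := Complex.ofReal_ne_zero.2 Real.pi_ne_zero
  have hterm : ∀ n : ℤ, Complex.exp (Complex.I * Real.pi * τ / 4) * Complex.exp (Complex.I * v)
      * jacobiTheta₂_term n (v / Real.pi + τ / 2 + 1 / 2) τ
      = (-1) ^ n * Complex.exp (Complex.I * Real.pi * τ * (n + 1 / 2) ^ 2)
        * Complex.exp ((2 * n + 1) * v * Complex.I) := by
    intro n
    rw [jacobiTheta₂_term, ← exp_pi_mul_I_int, ← Complex.exp_add, ← Complex.exp_add,
      ← Complex.exp_add, ← Complex.exp_add]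
    congr 1
    field_simp
    ring
  rw [jacobiTheta₂, ← tsum_nat_add_neg_add_one hsum, mul_assoc (-Complex.I), mul_assoc (-Complex.I),
    ← tsum_mul_left, ← tsum_mul_left, thetaOne, ← tsum_mul_left]
  refine tsum_congr fun n => ?_
  rw [mul_add, hterm, hterm, Complex.sin, neg_add_rev, zpow_add₀ (by norm_num), zpow_neg_one,
    inv_neg_one, zpow_neg, ← inv_zpow, inv_neg_one, zpow_natCast]
  have e1 : ((n : ℂ) + 1 / 2) ^ 2 = (((-1 + -(n : ℤ) : ℤ) : ℂ) + 1 / 2) ^ 2 := by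
    push_cast
    ring
  have e2 : (2 * ((-1 + -(n : ℤ) : ℤ) : ℂ) + 1) * v * Complex.I = -((2 * n + 1) * v) * Complex.I := by
    push_cast
    ring
  rw [← e1, e2]
  push_cast
  ring

theorem thetaOne_neg (τ v : ℂ) : thetaOne τ (-v) = -thetaOne τ v := by
  simp [thetaOne, tsum_neg]

theorem thetaFour_neg (τ v : ℂ) : thetaFour τ (-v) = thetaFour τ v := by
  simp [thetaFour]

/-! ### The continuous argument of the theta quotient -/

/-- The value of `ϑ₄` at `(u + iθ) / 2i`. -/
noncomputable def thetaLine (τ : ℂ) (θ u : ℝ) : ℂ :=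
  jacobiTheta₂ ((u + Complex.I * θ) / (2 * Real.pi * Complex.I) + 1 / 2) τ

theorem eq_I_mul_im {τ : ℂ} (hτ : τ.re = 0) : τ = Complex.I * τ.im := by
  apply Complex.ext <;> simp [hτ]

theorem exp_nome {τ : ℂ} (hτ : τ.re = 0) :
    Complex.exp (Real.pi * Complex.I * τ) = Real.exp (-(Real.pi * τ.im)) := by
  rw [Complex.ofReal_exp]
  congr 1
  nth_rw 1 [eq_I_mul_im hτ]
  push_cast
  linear_combination (Real.pi : ℂ) * τ.im * Complex.I_mul_I

theorem exp_thetaLine_arg (θ u : ℝ) : Complex.exp (2 * Real.pi * Complex.I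
    * ((u + Complex.I * θ) / (2 * Real.pi * Complex.I) + 1 / 2))
      = -Complex.exp (u + Complex.I * θ) := by
  have hpi : (Real.pi : ℂ) ≠ 0 := Complex.ofReal_ne_zero.2 Real.pi_ne_zero
  have hI := Complex.I_ne_zero
  have : 2 * Real.pi * Complex.I * ((u + Complex.I * θ) / (2 * Real.pi * Complex.I) + 1 / 2)
      = (u + Complex.I * θ) + Real.pi * Complex.I := by
    field_simp
  rw [this, Complex.exp_add, Complex.exp_pi_mul_I, mul_neg_one]

/-- For a rectangular lattice the nome is a positive real, so multiplying by its powers only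
translates the real variable `u`. This is what brings the (Q3) function `rayArg` into (Q4). -/
theorem one_add_nome_pow_mul {τ : ℂ} (hτ : τ.re = 0) (θ u : ℝ) (k : ℕ) :
    1 + Complex.exp (Real.pi * Complex.I * τ) ^ (2 * k + 1) * -Complex.exp (u + Complex.I * θ)
      = 1 - Complex.exp ((u - (2 * k + 1) * (Real.pi * τ.im) : ℝ) + Complex.I * θ) := by
  rw [exp_nome hτ, Complex.ofReal_exp, ← Complex.exp_nat_mul, mul_neg, ← Complex.exp_add,
    sub_eq_add_neg]
  congr 3
  push_cast
  ring

theorem one_add_nome_pow_mul_inv {τ : ℂ} (hτ : τ.re = 0) (θ u : ℝ) (k : ℕ) :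
    1 + Complex.exp (Real.pi * Complex.I * τ) ^ (2 * k + 1) * (-Complex.exp (u + Complex.I * θ))⁻¹
      = 1 - Complex.exp ((-u - (2 * k + 1) * (Real.pi * τ.im) : ℝ) + Complex.I * (-θ : ℝ)) := by
  rw [inv_neg, ← Complex.exp_neg, ← one_add_nome_pow_mul hτ]
  congr 4
  push_cast
  ring

theorem exp_line_ne_one {θ : ℝ} (h : Real.sin θ ≠ 0) (Z : ℝ) :
    1 - Complex.exp (Z + Complex.I * θ) ≠ 0 := by
  rw [exp_line]
  exact Complex.slitPlane_ne_zero (one_sub_ray_mem_slitPlane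
    (exp_I_mul_ne_one_of_sin_ne_zero h) (Real.exp_pos Z).le)

theorem thetaLine_ne_zero {τ : ℂ} (hτ : τ.re = 0) (hτ' : 0 < τ.im) {θ : ℝ} (h : Real.sin θ ≠ 0)
    (u : ℝ) : thetaLine τ θ u ≠ 0 := by
  refine jacobiTheta₂_ne_zero hτ' (fun k => ?_) (fun k => ?_)
  · rw [exp_thetaLine_arg, one_add_nome_pow_mul hτ]
    exact exp_line_ne_one h _
  · rw [exp_thetaLine_arg, one_add_nome_pow_mul_inv hτ]
    exact exp_line_ne_one (by rwa [Real.sin_neg, neg_ne_zero]) _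

theorem one_sub_exp_line_neg (θ Z : ℝ) : 1 - Complex.exp (Z + Complex.I * (-θ : ℝ))
    = starRingEnd ℂ (1 - Complex.exp (Z + Complex.I * θ)) := by
  simp [← Complex.exp_conj]

/-- A number divided by its conjugate has modulus one and twice the argument. -/
theorem one_sub_exp_line_div {θ : ℝ} (h : Real.sin θ ≠ 0) (Z : ℝ) :
    (1 - Complex.exp (Z + Complex.I * θ)) / (1 - Complex.exp (Z + Complex.I * (-θ : ℝ)))
      = Complex.exp (-2 * Complex.I * rayArg θ Z) := by
  have h0 := exp_line_ne_one h Z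
  rw [one_sub_exp_line_neg]
  nth_rw 1 [← Complex.exp_log h0]
  nth_rw 2 [← Complex.exp_log h0]
  rw [← Complex.exp_conj, ← Complex.exp_sub]
  congr 1
  apply Complex.ext <;> (simp [rayArg]; try ring)

/-- The continuous function `B` with `ϑ₄((u + iθ) / 2i) / ϑ₄((u - iθ) / 2i) = exp (-2iB(u))`. -/
noncomputable def thetaArg (a θ u : ℝ) : ℝ :=
  ∑' k : ℕ, (rayArg θ (u - (2 * k + 1) * a) - rayArg θ (-u - (2 * k + 1) * a))

/-- Exponential decay at `-∞` makes the series `thetaArg` converge like a geometric one. For `exp Z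
≥ 1 / 2` the bound `π` is enough. -/
theorem abs_rayArg_le_exp (θ Z : ℝ) : |rayArg θ Z| ≤ 2 * Real.pi * Real.exp Z := by
  rcases le_total (Real.exp Z) (1 / 2) with h | h
  · have hn : ‖-Complex.exp (Z + Complex.I * θ)‖ = Real.exp Z := by
      rw [norm_neg, Complex.norm_exp]
      simp
    have h1 := Complex.norm_log_one_add_half_le_self (z := -Complex.exp (Z + Complex.I * θ))
      (by rwa [hn])
    rw [hn, ← sub_eq_add_neg] at h1
    have h2 := Complex.abs_im_le_norm (Complex.log (1 - Complex.exp (Z + Complex.I * θ)))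
    rw [rayArg, abs_neg]
    have := Real.pi_gt_three
    have := Real.exp_pos Z
    nlinarith
  · refine (abs_rayArg_le_pi θ Z).trans ?_
    nlinarith [Real.pi_pos]

theorem summable_exp_neg_odd_mul {a : ℝ} (ha : 0 < a) :
    Summable fun k : ℕ => Real.exp (-((2 * k + 1) * a)) := by
  have hg := summable_geometric_of_lt_one (Real.exp_pos (-a)).le
    (Real.exp_lt_one_iff.2 (neg_lt_zero.2 ha))
  refine (hg.comp_injective (i := fun k : ℕ => 2 * k + 1) fun a b h => by simpa using h).congr
    fun k => ?_
  rw [Function.comp_apply, ← Real.exp_nat_mul]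
  congr 1
  push_cast
  ring

theorem norm_thetaArg_term_le {a θ u M : ℝ} (hu : |u| ≤ M) (k : ℕ) :
    ‖rayArg θ (u - (2 * k + 1) * a) - rayArg θ (-u - (2 * k + 1) * a)‖
      ≤ 4 * Real.pi * Real.exp M * Real.exp (-((2 * k + 1) * a)) := by
  have hu' := abs_le.1 hu
  have hM : ∀ v, v ≤ M →
      |rayArg θ (v - (2 * k + 1) * a)| ≤ 2 * Real.pi * Real.exp M * Real.exp (-((2 * k + 1) * a)) := by
    intro v hv
    refine (abs_rayArg_le_exp _ _).trans ?_
    rw [mul_assoc _ (Real.exp M), ← Real.exp_add]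
    gcongr
    linarith
  have := hM u hu'.2
  have := hM (-u) (by linarith)
  rw [Real.norm_eq_abs]
  refine (abs_sub _ _).trans ?_
  linarith

theorem summable_thetaArg {a : ℝ} (ha : 0 < a) (θ u : ℝ) : Summable fun k : ℕ =>
    rayArg θ (u - (2 * k + 1) * a) - rayArg θ (-u - (2 * k + 1) * a) :=
  ((summable_exp_neg_odd_mul ha).mul_left _).of_norm_bounded fun k => norm_thetaArg_term_le le_rfl k

theorem continuous_thetaArg {a : ℝ} (ha : 0 < a) {θ : ℝ} (h : Real.sin θ ≠ 0) :
    Continuous (thetaArg a θ) := by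
  rw [continuous_iff_continuousAt]
  intro u
  have hc := continuous_rayArg (exp_I_mul_ne_one_of_sin_ne_zero h)
  have : ContinuousOn (thetaArg a θ) (Metric.ball 0 (|u| + 1)) := by
    refine continuousOn_tsum (fun k => ?_) ((summable_exp_neg_odd_mul ha).mul_left _)
      fun k v hv => norm_thetaArg_term_le (M := |u| + 1) ?_ k
    · exact ((hc.comp (by fun_prop)).sub (hc.comp (by fun_prop))).continuousOn
    · simpa using (mem_ball_zero_iff.1 hv).le
  exact this.continuousAt (Metric.isOpen_ball.mem_nhds (by simp))

theorem strictMono_thetaArg {a : ℝ} (ha : 0 < a) {θ : ℝ} (h : 0 < Real.sin θ) :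
    StrictMono (thetaArg a θ) := by
  intro u v huv
  have hm := strictMono_rayArg h
  have hlt : ∀ k : ℕ, rayArg θ (u - (2 * k + 1) * a) - rayArg θ (-u - (2 * k + 1) * a)
      < rayArg θ (v - (2 * k + 1) * a) - rayArg θ (-v - (2 * k + 1) * a) := fun k => by
    have h1 := hm (sub_lt_sub_right huv ((2 * k + 1) * a))
    have h2 := hm (sub_lt_sub_right (neg_lt_neg huv) ((2 * k + 1) * a))
    linarith
  exact Summable.tsum_lt_tsum (fun k => (hlt k).le) (hlt 0) (summable_thetaArg ha θ u)
    (summable_thetaArg ha θ v)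

/-- Dividing the triple products for `θ` and `-θ` factor by factor gives exponentials of the terms
of `thetaArg`. The factors with the inverse carry `-θ`, and `rayArg` is odd in `θ`, whence the minus
sign in the series. -/
theorem thetaLine_div {τ : ℂ} (hτ : τ.re = 0) (hτ' : 0 < τ.im) {θ : ℝ} (h : Real.sin θ ≠ 0)
    (u : ℝ) : thetaLine τ θ u / thetaLine τ (-θ) u
      = Complex.exp (-2 * Complex.I * thetaArg (Real.pi * τ.im) θ u) := by
  have h' : Real.sin (-θ) ≠ 0 := by rwa [Real.sin_neg, neg_ne_zero]
  have ha : 0 < Real.pi * τ.im := mul_pos Real.pi_pos hτ'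
  obtain ⟨c, hc, hlim⟩ := exists_tendsto_triple_product hτ'
  have hnum := hlim ((u + Complex.I * θ) / (2 * Real.pi * Complex.I) + 1 / 2)
  have hden := hlim ((u + Complex.I * (-θ : ℝ)) / (2 * Real.pi * Complex.I) + 1 / 2)
  have hquot := hnum.div hden (mul_ne_zero (thetaLine_ne_zero hτ hτ' h' u) hc)
  rw [mul_div_mul_right _ _ hc] at hquot
  have hexp : Tendsto (fun N => Complex.exp (-2 * Complex.I * ((∑ k ∈ Finset.range N,
      (rayArg θ (u - (2 * k + 1) * (Real.pi * τ.im))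
        - rayArg θ (-u - (2 * k + 1) * (Real.pi * τ.im))) : ℝ) : ℂ))) atTop
      (𝓝 (Complex.exp (-2 * Complex.I * thetaArg (Real.pi * τ.im) θ u))) := by
    have hs := (summable_thetaArg ha θ u).hasSum.tendsto_sum_nat
    have hcont : Continuous fun x : ℝ => Complex.exp (-2 * Complex.I * (x : ℂ)) := by fun_prop
    exact (hcont.tendsto _).comp hs
  refine tendsto_nhds_unique (hquot.congr fun N => ?_) hexp
  rw [Pi.div_apply, ← Finset.prod_div_distrib, Complex.ofReal_sum, Finset.mul_sum, Complex.exp_sum]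
  refine Finset.prod_congr rfl fun k _ => ?_
  rw [exp_thetaLine_arg, exp_thetaLine_arg, one_add_nome_pow_mul hτ, one_add_nome_pow_mul hτ,
    one_add_nome_pow_mul_inv hτ, one_add_nome_pow_mul_inv hτ, mul_div_mul_comm,
    one_sub_exp_line_div h, one_sub_exp_line_div h', ← Complex.exp_add]
  have hneg : ∀ Z, rayArg (-θ) Z = -rayArg θ Z := by
    intro Z
    have hs : 1 - Complex.exp (Z + Complex.I * θ) ∈ Complex.slitPlane := by
      rw [exp_line]
      exact one_sub_ray_mem_slitPlane (exp_I_mul_ne_one_of_sin_ne_zero h) (Real.exp_pos Z).le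
    rw [rayArg, one_sub_exp_line_neg, Complex.log_conj _ (Complex.slitPlane_arg_ne_pi hs),
      Complex.conj_im, rayArg]
  rw [hneg]
  congr 1
  push_cast
  ring

theorem thetaFour_line {τ : ℂ} (hτ' : 0 < τ.im) (θ u : ℝ) :
    thetaFour τ ((u + Complex.I * θ) / (2 * Complex.I)) = thetaLine τ θ u := by
  rw [thetaFour_eq hτ', thetaLine]
  congr 2
  rw [div_div]
  congr 1
  ring

theorem thetaOne_line {τ : ℂ} (hτ : τ.re = 0) (hτ' : 0 < τ.im) (θ u : ℝ) :
    thetaOne τ ((u + Complex.I * θ) / (2 * Complex.I))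
      = -Complex.I * Complex.exp (Complex.I * Real.pi * τ / 4)
        * Complex.exp ((u + Complex.I * θ) / 2) * thetaLine τ θ (u - Real.pi * τ.im) := by
  have hpi : (Real.pi : ℂ) ≠ 0 := Complex.ofReal_ne_zero.2 Real.pi_ne_zero
  have hI := Complex.I_ne_zero
  have e1 : Complex.I * ((u + Complex.I * θ) / (2 * Complex.I)) = (u + Complex.I * θ) / 2 := by
    field_simp
  have e2 : (u + Complex.I * θ) / (2 * Complex.I) / Real.pi + τ / 2
      = (((u - Real.pi * τ.im : ℝ) : ℂ) + Complex.I * θ) / (2 * Real.pi * Complex.I) := by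
    nth_rw 1 [eq_I_mul_im hτ]
    push_cast
    field_simp
    linear_combination (Real.pi : ℂ) * τ.im * Complex.I_sq
  rw [thetaOne_eq hτ', thetaLine, e1, e2]

theorem thetaRatioFour_eq {τ : ℂ} (hτ : τ.re = 0) (hτ' : 0 < τ.im) {θ : ℝ} (h : Real.sin θ ≠ 0)
    (u : ℝ) : thetaRatioFour τ θ u
      = Complex.exp (-2 * Complex.I * thetaArg (Real.pi * τ.im) θ u) := by
  rw [← thetaLine_div hτ hτ' h, ← thetaFour_line hτ', ← thetaFour_line hτ', thetaRatioFour]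
  congr 3
  push_cast
  ring

/-- `ϑ₁` is `ϑ₄` translated by a half period, up to exponential factors whose quotient `exp (iθ)`
does not depend on `u`. So the argument is again `thetaArg`, translated, up to a constant. -/
theorem thetaRatioOne_eq {τ : ℂ} (hτ : τ.re = 0) (hτ' : 0 < τ.im) {θ : ℝ} (h : Real.sin θ ≠ 0)
    (u : ℝ) : thetaRatioOne τ θ u = -Complex.exp (Complex.I * θ)
      * Complex.exp (-2 * Complex.I * thetaArg (Real.pi * τ.im) θ (u - Real.pi * τ.im)) := by
  have h' : Real.sin (-θ) ≠ 0 := by rwa [Real.sin_neg, neg_ne_zero]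
  have e : (u : ℂ) - Complex.I * θ = u + Complex.I * (-θ : ℝ) := by
    push_cast
    ring
  rw [← thetaLine_div hτ hτ' h, thetaRatioOne, e, thetaOne_line hτ hτ', thetaOne_line hτ hτ',
    mul_div_mul_comm, mul_div_mul_comm, div_self, one_mul, ← Complex.exp_sub, neg_mul]
  · congr 3
    push_cast
    ring
  · exact mul_ne_zero (neg_ne_zero.2 Complex.I_ne_zero) (Complex.exp_ne_zero _)

theorem thetaRatioFour_zero {τ : ℂ} (hτ : τ.re = 0) (hτ' : 0 < τ.im) {θ : ℝ} (h : Real.sin θ ≠ 0) :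
    thetaRatioFour τ θ 0 = 1 := by
  have e : (((0 : ℝ) : ℂ) - Complex.I * θ) / (2 * Complex.I)
      = -((((0 : ℝ) : ℂ) + Complex.I * θ) / (2 * Complex.I)) := by
    push_cast
    ring
  rw [thetaRatioFour, e, thetaFour_neg, div_self]
  rw [thetaFour_line hτ']
  exact thetaLine_ne_zero hτ hτ' h 0

theorem thetaRatioOne_zero {τ : ℂ} (hτ : τ.re = 0) (hτ' : 0 < τ.im) {θ : ℝ} (h : Real.sin θ ≠ 0) :
    thetaRatioOne τ θ 0 = 1 := by
  have e : (((0 : ℝ) : ℂ) - Complex.I * θ) / (2 * Complex.I)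
      = -((((0 : ℝ) : ℂ) + Complex.I * θ) / (2 * Complex.I)) := by
    push_cast
    ring
  rw [thetaRatioOne, e, thetaOne_neg, div_neg, div_self, neg_neg]
  rw [thetaOne_line hτ hτ']
  exact mul_ne_zero (mul_ne_zero (mul_ne_zero (neg_ne_zero.2 Complex.I_ne_zero)
    (Complex.exp_ne_zero _)) (Complex.exp_ne_zero _)) (thetaLine_ne_zero hτ hτ' h _)

/-! ### Continuous logarithms -/

/-- Both are lifts of the same path through the covering map `exp`, with the same value at `0`. -/
theorem IsLogAlong.unique {g s s' : ℝ → ℂ} (h : IsLogAlong g s) (h' : IsLogAlong g s') : s = s' :=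
  Complex.isCoveringMap_exp.eq_of_comp_eq h.1 h'.1
    (funext fun u => Subtype.ext ((h.2.2 u).trans (h'.2.2 u).symm)) 0 (h.2.1.trans h'.2.1.symm)

theorem IsLogAlong.logAlong_eq {g s : ℝ → ℂ} (h : IsLogAlong g s) : logAlong g = s :=
  (Classical.epsilon_spec (p := IsLogAlong g) ⟨s, h⟩).unique h

/-- The normalisation `g 0 = 1` forces the value of `K`, so the constant is absorbed by subtracting
`B 0`. -/
theorem isLogAlong_of_eq_exp {g : ℝ → ℂ} {B : ℝ → ℝ} (hB : Continuous B) {K : ℂ}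
    (hg : ∀ u, g u = K * Complex.exp (-2 * Complex.I * B u)) (h0 : g 0 = 1) :
    IsLogAlong g fun u => -2 * Complex.I * ((B u - B 0 : ℝ) : ℂ) := by
  refine ⟨by fun_prop, by simp, fun u => ?_⟩
  have hK : K = (Complex.exp (-2 * Complex.I * B 0))⁻¹ :=
    eq_inv_of_mul_eq_one_left (by rw [← hg, h0])
  rw [hg, hK, ← Complex.exp_neg, ← Complex.exp_add]
  congr 1
  push_cast
  ring

theorem logIntegral_eq_ofReal {g : ℝ → ℂ} {B : ℝ → ℝ}
    (h : IsLogAlong g fun u => -2 * Complex.I * ((B u - B 0 : ℝ) : ℂ)) (Z : ℝ) :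
    logIntegral g Z = ((2 * ∫ u in (0 : ℝ)..Z, (B u - B 0) : ℝ) : ℂ) := by
  rw [logIntegral, h.logAlong_eq, intervalIntegral.integral_const_mul,
    intervalIntegral.integral_ofReal]
  push_cast
  linear_combination (-2 * ((∫ u in (0 : ℝ)..Z, (B u - B 0) : ℝ) : ℂ)) * Complex.I_mul_I

theorem strictConvexOn_integral_of_strictMono {B : ℝ → ℝ} (hB : Continuous B) (hm : StrictMono B) :
    StrictConvexOn ℝ Set.univ fun Z => 2 * ∫ u in (0 : ℝ)..Z, (B u - B 0) := by
  have hc : Continuous fun u => B u - B 0 := by fun_prop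
  refine strictConvexOn_univ_of_hasDerivAt (f' := fun Z => 2 * (B Z - B 0)) (fun Z => ?_)
    fun u v huv => ?_
  · exact (hc.integral_hasStrictDerivAt 0 Z).hasDerivAt.const_mul 2
  · have := hm huv
    simp only
    linarith

theorem exists_isLogAlong_thetaRatio {τ : ℂ} (hτ : τ.re = 0) (hτ' : 0 < τ.im) {θ : ℝ}
    (h : 0 < Real.sin θ) :
    (∃ B : ℝ → ℝ, Continuous B ∧ StrictMono B ∧
      IsLogAlong (thetaRatioOne τ θ) fun u => -2 * Complex.I * ((B u - B 0 : ℝ) : ℂ)) ∧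
    ∃ B : ℝ → ℝ, Continuous B ∧ StrictMono B ∧
      IsLogAlong (thetaRatioFour τ θ) fun u => -2 * Complex.I * ((B u - B 0 : ℝ) : ℂ) := by
  have ha : 0 < Real.pi * τ.im := mul_pos Real.pi_pos hτ'
  have hc := continuous_thetaArg ha h.ne'
  have hm := strictMono_thetaArg ha h
  constructor
  · have hc' : Continuous fun u => thetaArg (Real.pi * τ.im) θ (u - Real.pi * τ.im) := by fun_prop
    exact ⟨_, hc', fun u v huv => hm (sub_lt_sub_right huv _),
      isLogAlong_of_eq_exp hc' (thetaRatioOne_eq hτ hτ' h.ne') (thetaRatioOne_zero hτ hτ' h.ne')⟩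
  · exact ⟨_, hc, hm, isLogAlong_of_eq_exp hc (K := 1)
      (fun u => by rw [one_mul, thetaRatioFour_eq hτ hτ' h.ne'])
      (thetaRatioFour_zero hτ hτ' h.ne')⟩

theorem exists_edgeQ4_eq {τ : ℂ} (hτ : τ.re = 0) (hτ' : 0 < τ.im) {θ : ℝ} (h : 0 < Real.sin θ) :
    ∃ f : ℝ → ℝ, StrictConvexOn ℝ Set.univ f ∧
      ∀ X Y, edgeQ4 τ X Y θ = ((f (X - Y) + f (X + Y) : ℝ) : ℂ) := by
  obtain ⟨⟨B₁, hc₁, hm₁, h₁⟩, B₄, hc₄, hm₄, h₄⟩ := exists_isLogAlong_thetaRatio hτ hτ' h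
  refine ⟨_, (strictConvexOn_integral_of_strictMono hc₁ hm₁).add
    (strictConvexOn_integral_of_strictMono hc₄ hm₄), fun X Y => ?_⟩
  simp only [edgeQ4, logIntegral_eq_ofReal h₁, logIntegral_eq_ofReal h₄, Pi.add_apply]
  push_cast
  ring

/-! ### The action functional -/

namespace QuadGraph

variable {V D F : Type*} [Fintype V] [Fintype F] (G : QuadGraph V D F)

theorem action_im_eq_zero {Λ : ℝ → ℝ → ℝ → ℂ} {θ : F → ℝ} {Θ : G.WhiteVertex → ℝ}
    (h : ∀ e X Y, (Λ X Y (θ e)).im = 0) (X : G.WhiteVertex → ℝ) : (G.action Λ θ Θ X).im = 0 := by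
  rw [action, Complex.add_im, Complex.im_sum, Complex.im_sum]
  simp only [h, Complex.ofReal_im, Finset.sum_const_zero, add_zero]

/-- `L` collects the terms with `Θ` together with the linear terms of the edge functions, so that
neither influences convexity. -/
theorem exists_action_re_eq {Λ : ℝ → ℝ → ℝ → ℂ} {θ : F → ℝ} (Θ : G.WhiteVertex → ℝ)
    {f g : F → ℝ → ℝ} {α β : F → ℝ} (h : ∀ e X Y,
      (Λ X Y (θ e)).re = f e (X - Y) + g e (X + Y) + (α e * X + β e * Y)) :
    ∃ L : (G.WhiteVertex → ℝ) →ₗ[ℝ] ℝ, ∀ X, (G.action Λ θ Θ X).re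
      = ∑ e, f e (X (G.src e) - X (G.tgt e)) + ∑ e, g e (X (G.src e) + X (G.tgt e)) + L X := by
  let pr : G.WhiteVertex → (G.WhiteVertex → ℝ) →ₗ[ℝ] ℝ := fun x =>
    LinearMap.proj (R := ℝ) (φ := fun _ : G.WhiteVertex => ℝ) x
  refine ⟨∑ e, (α e • pr (G.src e) + β e • pr (G.tgt e)) + ∑ x, Θ x • pr x, fun X => ?_⟩
  rw [action, Complex.add_re, Complex.re_sum, Complex.re_sum]
  simp only [h, Complex.ofReal_re, Finset.sum_add_distrib, LinearMap.add_apply,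
    LinearMap.sum_apply, LinearMap.smul_apply, smul_eq_mul, pr, LinearMap.proj_apply]
  ring

variable {G}

theorem realStrictConvexOn_action_of_subset {Λ : ℝ → ℝ → ℝ → ℂ} {θ : F → ℝ}
    {Θ : G.WhiteVertex → ℝ} (hcon : G.WhiteConnected) {C : Set (G.WhiteVertex → ℝ)}
    (hC : Convex ℝ C) (hCU : C ⊆ G.subspaceU) (him : ∀ e X Y, (Λ X Y (θ e)).im = 0)
    {f : F → ℝ → ℝ} {α β : F → ℝ}
    (h : ∀ e X Y, (Λ X Y (θ e)).re = f e (X - Y) + (α e * X + β e * Y))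
    (hf : ∀ e, StrictConvexOn ℝ (edgeDiff G.src G.tgt e '' C) (f e)) :
    RealStrictConvexOn C (G.action Λ θ Θ) := by
  refine ⟨fun X _ => G.action_im_eq_zero him X, ?_⟩
  obtain ⟨L, hL⟩ := G.exists_action_re_eq Θ (g := 0) (f := f) (fun e X Y => by
    rw [h, Pi.zero_apply, Pi.zero_apply, add_zero])
  simp only [hL, Pi.zero_apply, Finset.sum_const_zero, add_zero]
  exact strictConvexOn_edge_sum_of_sum_eq_zero hcon hC hCU f _ hf
    (fun e X hX => ⟨X, hX, rfl⟩) L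

theorem realStrictConvexOn_action_subspaceU {Λ : ℝ → ℝ → ℝ → ℂ} {θ : F → ℝ}
    {Θ : G.WhiteVertex → ℝ} (hcon : G.WhiteConnected) (him : ∀ e X Y, (Λ X Y (θ e)).im = 0)
    {f : F → ℝ → ℝ} {α β : F → ℝ}
    (h : ∀ e X Y, (Λ X Y (θ e)).re = f e (X - Y) + (α e * X + β e * Y))
    (hf : ∀ e, StrictConvexOn ℝ Set.univ (f e)) :
    RealStrictConvexOn G.subspaceU (G.action Λ θ Θ) :=
  realStrictConvexOn_action_of_subset hcon convex_sum_eq_zero subset_rfl him h fun e =>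
    (hf e).subset (Set.subset_univ _) (convex_sum_eq_zero.linear_image _)

theorem realStrictConvexOn_action_univ {Λ : ℝ → ℝ → ℝ → ℂ} {θ : F → ℝ}
    {Θ : G.WhiteVertex → ℝ} (hcon : G.WhiteConnected) (hV : Nontrivial G.WhiteVertex)
    (him : ∀ e X Y, (Λ X Y (θ e)).im = 0) {f : F → ℝ → ℝ} {α β : F → ℝ}
    (h : ∀ e X Y, (Λ X Y (θ e)).re = f e (X - Y) + f e (X + Y) + (α e * X + β e * Y))
    (hf : ∀ e, StrictConvexOn ℝ Set.univ (f e)) :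
    RealStrictConvexOn Set.univ (G.action Λ θ Θ) := by
  refine ⟨fun X _ => G.action_im_eq_zero him X, ?_⟩
  obtain ⟨L, hL⟩ := G.exists_action_re_eq Θ h
  simp only [hL]
  exact strictConvexOn_univ_edge_sum hcon f f hf hf L

omit [Fintype V] in
theorem neg_action_re_eq {S : (G.WhiteVertex → ℝ) → ℂ} {f g : F → ℝ → ℝ}
    {L : (G.WhiteVertex → ℝ) →ₗ[ℝ] ℝ} (hL : ∀ X, (S X).re = ∑ e, f e (X (G.src e) - X (G.tgt e))
      + ∑ e, g e (X (G.src e) + X (G.tgt e)) + L X) (X : G.WhiteVertex → ℝ) :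
    -(S X).re = ∑ e, (fun Z => -f e Z) (X (G.src e) - X (G.tgt e))
      + ∑ e, (fun Z => -g e Z) (X (G.src e) + X (G.tgt e)) + (-L) X := by
  rw [hL, Finset.sum_neg_distrib, Finset.sum_neg_distrib, LinearMap.neg_apply]
  ring

/-- Localisation gives the second difference of `f (θ e)` at `0` with step `1` one weak sign, while
strict convexity of the opposite kind gives it the other, strictly. The concave case is the convex
one for `-S`. -/
theorem not_strictConvexOn_of_convexOn_subspaceU (hG : G.WhiteSimple) {Λ : ℝ → ℝ → ℝ → ℂ}
    {f : ℝ → ℝ → ℝ} {α β : ℝ → ℝ}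
    (h : ∀ θ X Y, (Λ X Y θ).re = f θ (X - Y) + (α θ * X + β θ * Y))
    (hf : ∀ θ, SecondDiffVanishes (f θ)) (θ : F → ℝ) (Θ : G.WhiteVertex → ℝ) :
    (ReConvexOn G.subspaceU (G.action Λ θ Θ) →
      ∀ e, ¬ StrictConvexOn ℝ Set.univ fun Z => -f (θ e) Z) ∧
    (ReConcaveOn G.subspaceU (G.action Λ θ Θ) → ∀ e, ¬ StrictConvexOn ℝ Set.univ (f (θ e))) := by
  obtain ⟨L, hL⟩ := G.exists_action_re_eq Θ (g := 0) (f := fun e => f (θ e))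
    (α := fun e => α (θ e)) (β := fun e => β (θ e)) (fun e X Y => by
      rw [h, Pi.zero_apply, Pi.zero_apply, add_zero])
  refine ⟨fun hc e hs => ?_, fun hc e hs => ?_⟩
  · have h1 := hs.second_diff_pos (z := 0) one_ne_zero trivial trivial
    have h2 := ConvexOn.edge_second_diff_nonneg_of_sum_eq_zero hG hL (fun e => hf (θ e)) rfl hc e 0 1
    linarith
  · have h1 := hs.second_diff_pos (z := 0) one_ne_zero trivial trivial
    have h2 := ConvexOn.edge_second_diff_nonneg_of_sum_eq_zero hG
      (S := fun X => -(G.action Λ θ Θ X).re) (g := fun e Z => -(0 : F → ℝ → ℝ) e Z)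
      (neg_action_re_eq hL) (fun e => (hf (θ e)).neg) (by funext e Z; simp) hc.neg e 0 1
    linarith

theorem not_strictConvexOn_of_convexOn_univ (hG : G.WhiteSimple) {Λ : ℝ → ℝ → ℝ → ℂ}
    {f : ℝ → ℝ → ℝ} {α β : ℝ → ℝ}
    (h : ∀ θ X Y, (Λ X Y θ).re = f θ (X - Y) + f θ (X + Y) + (α θ * X + β θ * Y))
    (hf : ∀ θ, SecondDiffVanishes (f θ)) (θ : F → ℝ) (Θ : G.WhiteVertex → ℝ) :
    (ReConvexOn Set.univ (G.action Λ θ Θ) →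
      ∀ e, ¬ StrictConvexOn ℝ Set.univ fun Z => -f (θ e) Z) ∧
    (ReConcaveOn Set.univ (G.action Λ θ Θ) → ∀ e, ¬ StrictConvexOn ℝ Set.univ (f (θ e))) := by
  obtain ⟨L, hL⟩ := G.exists_action_re_eq Θ fun e => h (θ e)
  refine ⟨fun hc e hs => ?_, fun hc e hs => ?_⟩
  · have h1 := hs.second_diff_pos (z := 0) one_ne_zero trivial trivial
    have h2 := ConvexOn.edge_second_diff_nonneg hG hL (fun e => hf (θ e)) (fun e => hf (θ e)) hc e 0 1
    linarith
  · have h1 := hs.second_diff_pos (z := 0) one_ne_zero trivial trivial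
    have h2 := ConvexOn.edge_second_diff_nonneg hG
      (S := fun X => -(G.action Λ θ Θ X).re) (neg_action_re_eq hL)
      (fun e => (hf (θ e)).neg) (fun e => (hf (θ e)).neg) hc.neg e 0 1
    linarith

/-! ### The edge functions split into functions of `X - Y` and `X + Y` and a linear part -/

theorem edgeQ1zero_re (θ X Y : ℝ) :
    (edgeQ1zero X Y θ).re = -θ * Real.log |X - Y| + (0 * X + 0 * Y) := by
  simp [edgeQ1zero]

theorem edgeQ1one_re (θ X Y : ℝ) : (edgeQ1one X Y θ).re
    = (logEdge θ (X - Y)).re + (0 * X + -(2 * Real.pi * Real.sign θ) * Y) := by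
  rw [edgeQ1one_eq, Complex.sub_re, Complex.ofReal_re]
  ring

theorem edgeQ2_re (θ X Y : ℝ) : (edgeQ2 X Y θ).re = (logEdge θ (X - Y)).re
    + (logEdge θ (X + Y)).re + (0 * X + -(2 * Real.pi * Real.sign θ) * Y) := by
  rw [edgeQ2_eq, Complex.sub_re, Complex.add_re, Complex.ofReal_re]
  ring

theorem edgeQ3zero_re (θ X Y : ℝ) : (edgeQ3zero X Y θ).re
    = imDilogSum (X - Y) θ + (-(Real.pi - θ) * X + -(Real.pi - θ) * Y) := by
  rw [edgeQ3zero, Complex.ofReal_re]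
  ring

theorem edgeQ3one_re (θ X Y : ℝ) : (edgeQ3one X Y θ).re
    = imDilogSum (X - Y) θ + imDilogSum (X + Y) θ + (0 * X + 0 * Y) := by
  rw [edgeQ3one, Complex.ofReal_re]
  ring

theorem logEdge_im {θ : ℝ} (hθ : θ ≠ 0) (Z : ℝ) : (logEdge θ Z).im = 0 := by
  rw [logEdge_eq_ofReal hθ, Complex.ofReal_im]

theorem realStrictConvexOn_edgeQ1zero {θ : F → ℝ} (hcon : G.WhiteConnected) (hθ : ∀ e, 0 < θ e)
    (Θ : G.WhiteVertex → ℝ) {C : Set (G.WhiteVertex → ℝ)} (hC : C ⊆ G.subspaceU ∩ G.offDiagonal)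
    (hconv : Convex ℝ C) : RealStrictConvexOn C (G.action edgeQ1zero θ Θ) := by
  refine realStrictConvexOn_action_of_subset hcon hconv (fun X hX => (hC hX).1)
    (fun e X Y => Complex.ofReal_im _) (fun e => edgeQ1zero_re (θ e)) fun e =>
      strictConvexOn_neg_mul_log_abs (hθ e) (hconv.linear_image _) ?_
  rintro ⟨X, hX, h0⟩
  exact (hC hX).2 e (sub_eq_zero.1 h0)

theorem labels_sign_of_convexOn_edgeQ1zero (hG : G.WhiteSimple) (θ : F → ℝ) (Θ : G.WhiteVertex → ℝ) :
    ((∀ C ⊆ G.subspaceU ∩ G.offDiagonal, Convex ℝ C →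
      ReConvexOn C (G.action edgeQ1zero θ Θ)) → ∀ e, 0 ≤ θ e) ∧
    ((∀ C ⊆ G.subspaceU ∩ G.offDiagonal, Convex ℝ C →
      ReConcaveOn C (G.action edgeQ1zero θ Θ)) → ∀ e, θ e ≤ 0) := by
  obtain ⟨L, hL⟩ := G.exists_action_re_eq (Λ := edgeQ1zero) (θ := θ) Θ (g := 0)
    (f := fun e Z => -θ e * Real.log |Z|) (α := 0) (β := 0) (fun e X Y => by
      rw [edgeQ1zero_re]
      simp)
  -- Centre `2` and step `1` keep the three points `1`, `2`, `3` on one side of the singularity.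
  have hlog : ∀ η : ℝ, 0 < η → 0 < -η * Real.log |2 + 1| + -η * Real.log |2 - 1|
      - 2 * (-η * Real.log |(2 : ℝ)|) := fun η hη =>
    (strictConvexOn_neg_mul_log_abs hη (convex_Ioi 0) (by simp)).second_diff_pos (z := 2)
      one_ne_zero (by rw [Set.mem_Ioi]; norm_num) (by rw [Set.mem_Ioi]; norm_num)
  refine ⟨fun hc e => ?_, fun hc e => ?_⟩
  · by_contra! hlt
    have h1 := hlog (-θ e) (by linarith)
    have h2 := edge_second_diff_nonneg_of_ne hG hL
      (fun e => secondDiffVanishes_neg_mul_log_abs (θ e)) rfl hc e one_pos one_lt_two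
    linarith
  · by_contra! hlt
    have h1 := hlog (θ e) hlt
    have h2 := edge_second_diff_nonneg_of_ne hG
      (S := fun X => -(G.action edgeQ1zero θ Θ X).re)
      (f := fun e Z => -(-θ e * Real.log |Z|)) (g := fun e Z => -(0 : F → ℝ → ℝ) e Z)
      (neg_action_re_eq (f := fun e Z => -θ e * Real.log |Z|) hL) (fun e => (secondDiffVanishes_neg_mul_log_abs (θ e)).neg) (by funext e Z; simp)
      (fun C hC hC' => (hc C hC hC').neg) e one_pos one_lt_two
    linarith

end QuadGraph

/-! ### The main theorem -/

theorem sin_pos_of_mem_upperHalfCircle {θ : ℝ}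
    (h : Complex.exp (Complex.I * θ) ∈ upperHalfCircle) : 0 < Real.sin θ := by
  simpa [Complex.exp_im] using h.2

theorem sin_neg_of_mem_lowerHalfCircle {θ : ℝ}
    (h : Complex.exp (Complex.I * θ) ∈ lowerHalfCircle) : Real.sin θ < 0 := by
  simpa [Complex.exp_im] using h.2

theorem theorem1 {V D F : Type*} [Fintype V] [Finite D] [Fintype F] (G : QuadGraph V D F)
    (θ : F → ℝ) (Θ : G.WhiteVertex → ℝ) :
    -- strict convexity
    (G.WhiteConnected → Nontrivial G.WhiteVertex →
      -- (Q1), δ = 0: on every convex part of the domain of definition in `U`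
      ((∀ e, 0 < θ e) → ∀ C ⊆ G.subspaceU ∩ G.offDiagonal, Convex ℝ C →
        RealStrictConvexOn C (G.action edgeQ1zero θ Θ)) ∧
      -- (Q1), δ = 1
      ((∀ e, 0 < θ e) → RealStrictConvexOn G.subspaceU (G.action edgeQ1one θ Θ)) ∧
      -- (Q2)
      ((∀ e, 0 < θ e) → RealStrictConvexOn Set.univ (G.action edgeQ2 θ Θ)) ∧
      -- (Q3), δ = 0
      ((∀ e, Complex.exp (Complex.I * θ e) ∈ upperHalfCircle) →
        RealStrictConvexOn G.subspaceU (G.action edgeQ3zero θ Θ)) ∧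
      -- (Q3), δ = 1
      ((∀ e, Complex.exp (Complex.I * θ e) ∈ upperHalfCircle) →
        RealStrictConvexOn Set.univ (G.action edgeQ3one θ Θ)) ∧
      -- (Q4), rectangular lattice; the logarithms in the functional exist
      ((∀ e, Complex.exp (Complex.I * θ e) ∈ upperHalfCircle) →
        ∀ τ : ℂ, τ.re = 0 → 0 < τ.im →
          (∀ e, IsLogAlong (thetaRatioOne τ (θ e)) (logAlong (thetaRatioOne τ (θ e))) ∧
            IsLogAlong (thetaRatioFour τ (θ e)) (logAlong (thetaRatioFour τ (θ e)))) ∧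
          RealStrictConvexOn Set.univ (G.action (edgeQ4 τ) θ Θ))) ∧
    -- converse: if the functional is convex (or concave), no two labels have opposite signs
    (G.WhiteSimple →
      ((∀ C ⊆ G.subspaceU ∩ G.offDiagonal, Convex ℝ C →
          ReConvexOn C (G.action edgeQ1zero θ Θ)) → ∀ e, 0 ≤ θ e) ∧
      ((∀ C ⊆ G.subspaceU ∩ G.offDiagonal, Convex ℝ C →
          ReConcaveOn C (G.action edgeQ1zero θ Θ)) → ∀ e, θ e ≤ 0) ∧
      (ReConvexOn G.subspaceU (G.action edgeQ1one θ Θ) → ∀ e, 0 ≤ θ e) ∧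
      (ReConcaveOn G.subspaceU (G.action edgeQ1one θ Θ) → ∀ e, θ e ≤ 0) ∧
      (ReConvexOn Set.univ (G.action edgeQ2 θ Θ) → ∀ e, 0 ≤ θ e) ∧
      (ReConcaveOn Set.univ (G.action edgeQ2 θ Θ) → ∀ e, θ e ≤ 0) ∧
      (ReConvexOn G.subspaceU (G.action edgeQ3zero θ Θ) →
        ∀ e, Complex.exp (Complex.I * θ e) ∉ lowerHalfCircle) ∧
      (ReConcaveOn G.subspaceU (G.action edgeQ3zero θ Θ) →
        ∀ e, Complex.exp (Complex.I * θ e) ∉ upperHalfCircle) ∧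
      (ReConvexOn Set.univ (G.action edgeQ3one θ Θ) →
        ∀ e, Complex.exp (Complex.I * θ e) ∉ lowerHalfCircle) ∧
      (ReConcaveOn Set.univ (G.action edgeQ3one θ Θ) →
        ∀ e, Complex.exp (Complex.I * θ e) ∉ upperHalfCircle)) := by
  refine ⟨fun hcon hV => ⟨fun hθ C hC hconv => ?_, fun hθ => ?_, fun hθ => ?_, fun hθ => ?_,
    fun hθ => ?_, fun hθ τ hτ hτ' => ⟨fun e => ?_, ?_⟩⟩, fun hG => ?_⟩
  · exact QuadGraph.realStrictConvexOn_edgeQ1zero hcon hθ Θ hC hconv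
  · exact QuadGraph.realStrictConvexOn_action_subspaceU hcon
      (fun e X Y => by
        rw [edgeQ1one_eq, Complex.sub_im, QuadGraph.logEdge_im (hθ e).ne', Complex.ofReal_im, sub_zero])
      (fun e => QuadGraph.edgeQ1one_re (θ e)) fun e => strictConvexOn_logEdge (hθ e)
  · exact QuadGraph.realStrictConvexOn_action_univ hcon hV
      (fun e X Y => by
        rw [edgeQ2_eq, Complex.sub_im, Complex.add_im, QuadGraph.logEdge_im (hθ e).ne',
          QuadGraph.logEdge_im (hθ e).ne', Complex.ofReal_im, add_zero, sub_zero])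
      (fun e => QuadGraph.edgeQ2_re (θ e)) fun e => strictConvexOn_logEdge (hθ e)
  · exact QuadGraph.realStrictConvexOn_action_subspaceU hcon (fun e X Y => Complex.ofReal_im _)
      (fun e => QuadGraph.edgeQ3zero_re (θ e))
      fun e => strictConvexOn_imDilogSum (sin_pos_of_mem_upperHalfCircle (hθ e))
  · exact QuadGraph.realStrictConvexOn_action_univ hcon hV (fun e X Y => Complex.ofReal_im _)
      (fun e => QuadGraph.edgeQ3one_re (θ e))
      fun e => strictConvexOn_imDilogSum (sin_pos_of_mem_upperHalfCircle (hθ e))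
  · obtain ⟨⟨_, _, _, h₁⟩, _, _, _, h₄⟩ :=
      exists_isLogAlong_thetaRatio hτ hτ' (sin_pos_of_mem_upperHalfCircle (hθ e))
    rw [h₁.logAlong_eq, h₄.logAlong_eq]
    exact ⟨h₁, h₄⟩
  · choose f hf h using fun e => exists_edgeQ4_eq hτ hτ' (sin_pos_of_mem_upperHalfCircle (hθ e))
    exact QuadGraph.realStrictConvexOn_action_univ (α := 0) (β := 0) hcon hV
      (fun e X Y => by rw [h, Complex.ofReal_im])
      (fun e X Y => by rw [h, Complex.ofReal_re]; simp) hf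
  · have hQ1zero := QuadGraph.labels_sign_of_convexOn_edgeQ1zero hG θ Θ
    have hQ1one := QuadGraph.not_strictConvexOn_of_convexOn_subspaceU hG QuadGraph.edgeQ1one_re
      secondDiffVanishes_logEdge θ Θ
    have hQ2 := QuadGraph.not_strictConvexOn_of_convexOn_univ hG QuadGraph.edgeQ2_re
      secondDiffVanishes_logEdge θ Θ
    have hQ3zero := QuadGraph.not_strictConvexOn_of_convexOn_subspaceU hG
      (f := fun η Z => imDilogSum Z η) QuadGraph.edgeQ3zero_re secondDiffVanishes_imDilogSum θ Θ
    have hQ3one := QuadGraph.not_strictConvexOn_of_convexOn_univ hG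
      (f := fun η Z => imDilogSum Z η) QuadGraph.edgeQ3one_re secondDiffVanishes_imDilogSum θ Θ
    refine ⟨hQ1zero.1, hQ1zero.2, fun h e => ?_, fun h e => ?_, fun h e => ?_, fun h e => ?_,
      fun h e he => ?_, fun h e he => ?_, fun h e he => ?_, fun h e he => ?_⟩
    · exact not_lt.1 fun hlt => hQ1one.1 h e (strictConvexOn_neg_logEdge hlt)
    · exact not_lt.1 fun hlt => hQ1one.2 h e (strictConvexOn_logEdge hlt)
    · exact not_lt.1 fun hlt => hQ2.1 h e (strictConvexOn_neg_logEdge hlt)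
    · exact not_lt.1 fun hlt => hQ2.2 h e (strictConvexOn_logEdge hlt)
    · exact hQ3zero.1 h e (strictConvexOn_neg_imDilogSum (sin_neg_of_mem_lowerHalfCircle he))
    · exact hQ3zero.2 h e (strictConvexOn_imDilogSum (sin_pos_of_mem_upperHalfCircle he))
    · exact hQ3one.1 h e (strictConvexOn_neg_imDilogSum (sin_neg_of_mem_lowerHalfCircle he))
    · exact hQ3one.2 h e (strictConvexOn_imDilogSum (sin_pos_of_mem_upperHalfCircle he))
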